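/- Let $K$ be a countable field, let $A=K\langle x,y\rangle$ be the free associative $K$-algebra on two non-commuting indeterminates, let $H(n)\subseteq A$ be the span of the monomials of degree $n$, and let $\bar A\subseteq A$ be the (non-unital) subalgebra of polynomials with zero constant term. Then there is a two-sided ideal $E$ of the $K$-algebra $\bar A$ (a $K$-subspace with $\bar A E\subseteq E$ and $E\bar A\subseteq E$) such that the quotient algebra $R=\bar A/E$ has the following properties. (1) $R$ is graded by degree: if $R_n$ denotes the image of $H(n)\cap \bar A$ in $R$ (so $R_0=0$), then $R=\bigoplus_{n\ge 0} R_n$ and $R_mR_n\subseteq R_{m+n}$ for all $m,n$. (2) $R$ is generated, as a non-unital $K$-algebra, by the images of $x$ and $y$. (3) $R$ is nil: for every $a\in R$ there is $n\ge 1$ with $a^n=0$. (4) $R$ is infinite dimensional over $K$. (5) $R$ has Gelfand–Kirillov dimension at most $3$, where $$\operatorname{GKdim}(R)=\sup_V\ \limsup_{n\to\infty}\frac{\log\dim_K(V+V^2+\cdots+V^n)}{\log n},$$ the supremum being over all finite dimensional $K$-subspaces $V$ of $R$ (with the convention $\log 0=0$ for $V=0$). -/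

import Mathlib

/-! Algebras here are associative and need not have a unit. -/

/-- A two-sided ideal of a (not necessarily unital) `K`-algebra `R`: a `K`-subspace which is closed
under multiplication by elements of `R` on both sides. -/
structure AlgIdeal (K R : Type*) [Field K] [NonUnitalRing R] [Module K R] extends
    Submodule K R where
  mul_mem_left' : ∀ (r : R) {a : R}, a ∈ carrier → r * a ∈ carrier
  mul_mem_right' : ∀ (r : R) {a : R}, a ∈ carrier → a * r ∈ carrier

namespace AlgIdeal

variable {K R : Type*} [Field K] [NonUnitalRing R] [Module K R]

/-- The quotient algebra `R / I`. -/
def Quotient (I : AlgIdeal K R) : Type _ := R ⧸ I.toSubmodule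

variable (I : AlgIdeal K R)

instance : AddCommGroup I.Quotient := inferInstanceAs (AddCommGroup (R ⧸ I.toSubmodule))

instance : Module K I.Quotient := inferInstanceAs (Module K (R ⧸ I.toSubmodule))

/-- The canonical projection `R → R / I`. -/
def proj : R →ₗ[K] I.Quotient := I.toSubmodule.mkQ

theorem proj_surjective : Function.Surjective I.proj := I.toSubmodule.mkQ_surjective

theorem proj_eq_proj {a b : R} : I.proj a = I.proj b ↔ a - b ∈ I.toSubmodule :=
  Submodule.Quotient.eq I.toSubmodule

/-- Multiplication on the quotient, `(a + I) * (b + I) = a * b + I`. -/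
instance : Mul I.Quotient :=
  ⟨_root_.Quotient.map₂ (· * ·) (by
    intro a b hab c d hcd
    rw [← Quotient.eq_iff_equiv] at hab hcd ⊢
    have h1 : a - b ∈ I.toSubmodule := I.proj_eq_proj.1 hab
    have h2 : c - d ∈ I.toSubmodule := I.proj_eq_proj.1 hcd
    refine I.proj_eq_proj.2 ?_
    have h3 : a * c - b * d = (a - b) * c + b * (c - d) := by
      rw [sub_mul, mul_sub]; abel
    rw [h3]
    exact I.toSubmodule.add_mem (I.mul_mem_right' c h1) (I.mul_mem_left' b h2))⟩

theorem proj_mul (a b : R) : I.proj (a * b) = I.proj a * I.proj b := rfl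

instance : NonUnitalRing I.Quotient where
  left_distrib a b c := by
    obtain ⟨a, rfl⟩ := I.proj_surjective a
    obtain ⟨b, rfl⟩ := I.proj_surjective b
    obtain ⟨c, rfl⟩ := I.proj_surjective c
    simp only [← map_add, ← proj_mul, mul_add]
  right_distrib a b c := by
    obtain ⟨a, rfl⟩ := I.proj_surjective a
    obtain ⟨b, rfl⟩ := I.proj_surjective b
    obtain ⟨c, rfl⟩ := I.proj_surjective c
    simp only [← map_add, ← proj_mul, add_mul]
  zero_mul a := by
    obtain ⟨a, rfl⟩ := I.proj_surjective a
    rw [← map_zero I.proj, ← proj_mul, zero_mul]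
  mul_zero a := by
    obtain ⟨a, rfl⟩ := I.proj_surjective a
    rw [← map_zero I.proj, ← proj_mul, mul_zero]
  mul_assoc a b c := by
    obtain ⟨a, rfl⟩ := I.proj_surjective a
    obtain ⟨b, rfl⟩ := I.proj_surjective b
    obtain ⟨c, rfl⟩ := I.proj_surjective c
    simp only [← proj_mul, mul_assoc]

instance [IsScalarTower K R R] : IsScalarTower K I.Quotient I.Quotient where
  smul_assoc k a b := by
    obtain ⟨a, rfl⟩ := I.proj_surjective a
    obtain ⟨b, rfl⟩ := I.proj_surjective b
    simp only [smul_eq_mul, ← map_smul, ← proj_mul, smul_mul_assoc]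

instance [SMulCommClass K R R] : SMulCommClass K I.Quotient I.Quotient where
  smul_comm k a b := by
    obtain ⟨a, rfl⟩ := I.proj_surjective a
    obtain ⟨b, rfl⟩ := I.proj_surjective b
    simp only [smul_eq_mul, ← map_smul, ← proj_mul, mul_smul_comm]

end AlgIdeal

/-- `powSucc a n` is the power `a ^ (n + 1)` in a ring without unit. -/
def powSucc {R : Type*} [NonUnitalRing R] (a : R) : ℕ → R
  | 0 => a
  | n + 1 => powSucc a n * a

/-- Every element of `R` is nilpotent. -/
def IsNilAlgebra (R : Type*) [NonUnitalRing R] : Prop :=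
  ∀ a : R, ∃ n : ℕ, powSucc a n = 0

section GK

variable (K R : Type*) [Field K] [NonUnitalRing R] [Module K R] [IsScalarTower K R R]
  [SMulCommClass K R R]

variable {K R} in
/-- `subspacePowSucc V n` is `V ^ (n + 1)`, the span of the products of `n + 1` elements of `V`. -/
def subspacePowSucc (V : Submodule K R) : ℕ → Submodule K R
  | 0 => V
  | n + 1 => Submodule.map₂ (LinearMap.mul K R) (subspacePowSucc V n) V

variable {K R} in
/-- The growth function `n ↦ dim (V + V ^ 2 + ⋯ + V ^ n)` of a subspace `V`. -/
noncomputable def growth (V : Submodule K R) (n : ℕ) : ℕ :=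
  Module.finrank K ↥(⨆ i : Fin n, subspacePowSucc V i)

/-- The Gelfand–Kirillov dimension: the supremum, over all finite dimensional subspaces `V` of `R`,
of `limsup (log (dim (V + ⋯ + V ^ n)) / log n)`. -/
noncomputable def GKdim : EReal :=
  ⨆ V : {V : Submodule K R // Module.Finite K ↥V},
    Filter.limsup (fun n : ℕ => ((Real.log (growth V.1 n) / Real.log n : ℝ) : EReal)) Filter.atTop

end GK

/-- The polynomials with zero constant term in the free algebra `K⟨x, y⟩`. -/
def augIdeal (K : Type*) [Field K] : NonUnitalSubalgebra K (FreeAlgebra K (Fin 2)) where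
  carrier := {a | FreeAlgebra.algebraMapInv a = 0}
  add_mem' := fun {a b} (ha : _ = _) (hb : _ = _) => by
    simp only [Set.mem_ofPred_eq, map_add, ha, hb, add_zero]
  zero_mem' := by simp only [Set.mem_ofPred_eq, map_zero]
  mul_mem' := fun {a b} (ha : _ = _) (_ : _ = _) => by
    simp only [Set.mem_ofPred_eq, map_mul, ha, zero_mul]
  smul_mem' := fun k a (ha : _ = _) => by
    simp only [Set.mem_ofPred_eq, map_smul, ha, smul_zero]

/-- The indeterminates `x` (for `i = 0`) and `y` (for `i = 1`), as elements of `augIdeal K`. -/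
def augVar (K : Type*) [Field K] (i : Fin 2) : augIdeal K :=
  ⟨FreeAlgebra.ι K i, by
    change FreeAlgebra.algebraMapInv (FreeAlgebra.ι K i) = 0
    simp [FreeAlgebra.algebraMapInv]⟩

/-- `homogeneousPart K n` is the span of the monomials of degree `n` in `K⟨x, y⟩`. -/
def homogeneousPart (K : Type*) [Field K] (n : ℕ) : Submodule K (FreeAlgebra K (Fin 2)) :=
  Submodule.span K
    {a | ∃ w : List (Fin 2), w.length = n ∧ a = (w.map (FreeAlgebra.ι K)).prod}

/-- The image in `augIdeal K / E` of the homogeneous polynomials of degree `n` that lie in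
`augIdeal K` (all of them if `n ≥ 1`, only `0` if `n = 0`). -/
def quotientPart {K : Type*} [Field K] (E : AlgIdeal K (augIdeal K)) (n : ℕ) :
    Submodule K E.Quotient :=
  ((homogeneousPart K n).comap (augIdeal K).toSubmodule.subtype).map E.proj

/-! The ideal is obtained by duality. For the bilinear form that makes the monomials orthonormal,
division by a letter is adjoint to multiplication by it, so the polynomials orthogonal to a space
`L` closed under removal of first and last letters form a two-sided ideal. If `L` is graded, so is
the quotient `R`, and `dim R_m` is bounded by the dimension of the degree `m` part of `L`. Thus `L`
has to be infinite dimensional, of slow growth, and orthogonal to some power of every polynomial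
without constant term.

Take for `L` all factors of polynomials `g k 0`, `g k 1` of degree `n k`, starting from the letters,
with `g (k + 1) i = (g k 0) ^ e k * ψ k i (g k 0, g k 1)` and `ψ k i` of degree `2 * γ k`.
Substitution of an independent pair is injective (`eq_zero_of_substitute_eq_zero`), so every pair
stays independent; in particular `g k 0 ≠ 0`, and `R` is infinite dimensional.

Nil: by countability, list all candidates as `f k`. At every position the powers of `f k` have
segments of length `w` in a space of dimension at most `C k * w` (`exists_segments`). For `w = 2 * γ
k * n k` this is smaller by at least two than the number `2 ^ (2 * γ k)` of patterns, so `ψ k` can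
be chosen with both substituted polynomials orthogonal to these segments
(`exists_annihilating_pair`). A factor of degree at least `2 * n (k + 1)` contains a whole block of
stage `k + 1`, hence such a polynomial, and the form is multiplicative on aligned products; so a
power of `f k` is orthogonal to `L` (`Tower.pairing_pow_eq_zero`).

Growth: for `n (k + 1) < m ≤ n (k + 2)` a factor of degree `m` meets at most two blocks of stage `k
+ 2`. Powers of the single polynomial `g (k + 1) 0` cost no dimension, whence `dim R_m ≤ 8 (m + 1) 2
^ (2 γ (k + 1)) M ^ 2` (`factors_step`), where `M` bounds the one-sided quotients of stage `k + 1`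
independently of `e k` (`quotients_step`). With `e k` huge, `M` is at most `n (k + 1) ^ (1 / (k +
1))`, while `2 ^ (2 γ (k + 1))` is about `n (k + 1)`. So `dim R_m = O(m ^ (2 + ε))`, and summation
over degrees gives dimension at most `3`. -/

open Module

/-! ### Words, division by letters and the pairing -/

section Words

variable (K : Type*) [Field K]

/-- The free algebra on two indeterminates. -/
abbrev FreeTwo := FreeAlgebra K (Fin 2)

/-- The monomial with the given word of indeterminates. -/
def monomialOf (w : List (Fin 2)) : FreeTwo K := (w.map (FreeAlgebra.ι K)).prod

@[simp] theorem monomialOf_nil : monomialOf K [] = 1 := rfl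

@[simp] theorem monomialOf_cons (i : Fin 2) (w : List (Fin 2)) :
    monomialOf K (i :: w) = FreeAlgebra.ι K i * monomialOf K w := by
  simp [monomialOf]

theorem monomialOf_append (u w : List (Fin 2)) :
    monomialOf K (u ++ w) = monomialOf K u * monomialOf K w := by
  simp [monomialOf]

/-- The monomials form a basis of the free algebra. -/
noncomputable def monomialBasis : Basis (List (Fin 2)) K (FreeTwo K) :=
  (FreeAlgebra.basisFreeMonoid K (Fin 2)).reindex FreeMonoid.toList

@[simp] theorem monomialBasis_apply (w : List (Fin 2)) :
    monomialBasis K w = monomialOf K w := by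
  simp only [monomialBasis, Basis.reindex_apply, FreeAlgebra.basisFreeMonoid, Basis.map_apply]
  change FreeAlgebra.equivMonoidAlgebraFreeMonoid.symm (MonoidAlgebra.single _ 1) = _
  change MonoidAlgebra.lift K _ _ _ (MonoidAlgebra.single _ 1) = _
  rw [MonoidAlgebra.lift_single, one_smul, FreeMonoid.lift_apply]
  rfl

variable {K}

theorem ext_monomial {M : Type*} [AddCommGroup M] [Module K M] {f g : FreeTwo K →ₗ[K] M}
    (h : ∀ w, f (monomialOf K w) = g (monomialOf K w)) : f = g :=
  (monomialBasis K).ext (by simpa using h)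

theorem span_monomial : Submodule.span K (Set.range (monomialOf K)) = ⊤ := by
  rw [← (monomialBasis K).span_eq]
  congr 1
  ext; simp

theorem homogeneousPart_eq_span (n : ℕ) :
    homogeneousPart K n = Submodule.span K (monomialOf K '' {w | w.length = n}) := by
  unfold homogeneousPart
  congr 1
  ext a
  constructor
  · rintro ⟨w, h, rfl⟩; exact ⟨w, h, rfl⟩
  · rintro ⟨w, h, rfl⟩; exact ⟨w, h, rfl⟩

theorem monomialOf_mem {n : ℕ} {w : List (Fin 2)} (h : w.length = n) :
    monomialOf K w ∈ homogeneousPart K n := by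
  rw [homogeneousPart_eq_span]; exact Submodule.subset_span ⟨w, h, rfl⟩

theorem homogeneousPart_le {n : ℕ} {V : Submodule K (FreeTwo K)}
    (h : ∀ w : List (Fin 2), w.length = n → monomialOf K w ∈ V) : homogeneousPart K n ≤ V := by
  rw [homogeneousPart_eq_span, Submodule.span_le]
  rintro _ ⟨w, hw, rfl⟩
  exact h w hw

theorem homogeneousPart_zero : homogeneousPart K 0 = 1 := by
  rw [homogeneousPart_eq_span, Submodule.one_eq_span]
  congr 1
  ext a
  simp [@eq_comm _ a]

theorem homogeneousPart_mul (m n : ℕ) :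
    homogeneousPart K m * homogeneousPart K n = homogeneousPart K (m + n) := by
  apply le_antisymm
  · rw [homogeneousPart_eq_span, homogeneousPart_eq_span, Submodule.span_mul_span,
      Submodule.span_le]
    rintro _ ⟨_, ⟨u, hu, rfl⟩, _, ⟨w, hw, rfl⟩, rfl⟩
    simp only [Set.mem_ofPred_eq] at hu hw
    simp only [← monomialOf_append]
    exact monomialOf_mem (by simp [hu, hw])
  · refine homogeneousPart_le fun w hw => ?_
    rw [← List.take_append_drop m w, monomialOf_append]
    exact Submodule.mul_mem_mul (monomialOf_mem (by simp [hw])) (monomialOf_mem (by simp [hw]))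

theorem homogeneousPart_pow (m n : ℕ) :
    homogeneousPart K m ^ n = homogeneousPart K (n * m) := by
  induction n with
  | zero => simp [homogeneousPart_zero]
  | succ n ih => rw [pow_succ, ih, homogeneousPart_mul, Nat.succ_mul]

theorem ι_mem (i : Fin 2) : FreeAlgebra.ι K i ∈ homogeneousPart K 1 := by
  have := monomialOf_mem (K := K) (w := [i]) rfl
  simpa using this

/-- Reversal of words. -/
noncomputable def reversal : FreeTwo K ≃ₗ[K] FreeTwo K :=
  FreeAlgebra.starHom.toLinearEquiv.trans (MulOpposite.opLinearEquiv K).symm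

theorem reversal_mul (a b : FreeTwo K) : reversal (a * b) = reversal b * reversal a := by
  simp [reversal]

@[simp] theorem reversal_one : reversal (1 : FreeTwo K) = 1 := by
  simp [reversal]

@[simp] theorem reversal_ι (i : Fin 2) : reversal (FreeAlgebra.ι K i) = FreeAlgebra.ι K i := by
  change star _ = _
  simp

@[simp] theorem reversal_reversal (a : FreeTwo K) : reversal (reversal a) = a :=
  star_star a

theorem reversal_monomialOf (w : List (Fin 2)) :
    reversal (monomialOf K w) = monomialOf K w.reverse := by
  induction w with
  | nil => simp
  | cons i w ih => simp [reversal_mul, ih, monomialOf_append]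

/-- Removal of the first indeterminate `i` of a word. -/
noncomputable def leftDiv (i : Fin 2) : FreeTwo K →ₗ[K] FreeTwo K :=
  (monomialBasis K).constr K fun w => match w with
    | [] => 0
    | j :: t => if j = i then monomialOf K t else 0

theorem leftDiv_monomialOf (i : Fin 2) (w : List (Fin 2)) :
    leftDiv i (monomialOf K w) = match w with
    | [] => 0
    | j :: t => if j = i then monomialOf K t else 0 := by
  rw [leftDiv, ← monomialBasis_apply, Basis.constr_basis]

@[simp] theorem leftDiv_one (i : Fin 2) : leftDiv i (1 : FreeTwo K) = 0 :=
  leftDiv_monomialOf i []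

@[simp] theorem leftDiv_ι_mul (i j : Fin 2) (a : FreeTwo K) :
    leftDiv i (FreeAlgebra.ι K j * a) = if j = i then a else 0 := by
  have : (leftDiv i ∘ₗ LinearMap.mulLeft K (FreeAlgebra.ι K j) : FreeTwo K →ₗ[K] FreeTwo K) =
      if j = i then LinearMap.id else 0 := by
    refine ext_monomial fun w => ?_
    rw [LinearMap.comp_apply, LinearMap.mulLeft_apply, ← monomialOf_cons, leftDiv_monomialOf]
    by_cases h : j = i <;> simp [h]
  have h2 := LinearMap.congr_fun this a
  simp only [LinearMap.comp_apply, LinearMap.mulLeft_apply] at h2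
  rw [h2]; split_ifs <;> simp

/-- Removal of the last indeterminate `i` of a word. -/
noncomputable def rightDiv (i : Fin 2) : FreeTwo K →ₗ[K] FreeTwo K :=
  reversal.toLinearMap ∘ₗ leftDiv i ∘ₗ reversal.toLinearMap

theorem rightDiv_apply (i : Fin 2) (a : FreeTwo K) :
    rightDiv i a = reversal (leftDiv i (reversal a)) := rfl

@[simp] theorem rightDiv_one (i : Fin 2) : rightDiv i (1 : FreeTwo K) = 0 := by
  simp [rightDiv_apply]

@[simp] theorem rightDiv_mul_ι (i j : Fin 2) (a : FreeTwo K) :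
    rightDiv i (a * FreeAlgebra.ι K j) = if j = i then a else 0 := by
  rw [rightDiv_apply, reversal_mul, reversal_ι, leftDiv_ι_mul]
  split_ifs <;> simp

theorem sum_ι_mul_leftDiv {n : ℕ} {a : FreeTwo K} (ha : a ∈ homogeneousPart K (n + 1)) :
    ∑ i, FreeAlgebra.ι K i * leftDiv i a = a := by
  rw [homogeneousPart_eq_span] at ha
  induction ha using Submodule.span_induction with
  | mem a h =>
    obtain ⟨w, hw, rfl⟩ := h
    match w, hw with
    | i :: w, hw =>
      simp [Finset.sum_ite_eq]
  | zero => simp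
  | add a b _ _ ha hb => simp only [map_add, mul_add, Finset.sum_add_distrib, ha, hb]
  | smul c a _ ha => simp only [map_smul, mul_smul_comm, ← Finset.smul_sum, ha]

/-- For a constant `a` the division would reach into `b`, hence the degree `n + 1`. -/
theorem leftDiv_mul {n : ℕ} {a : FreeTwo K} (ha : a ∈ homogeneousPart K (n + 1)) (i : Fin 2)
    (b : FreeTwo K) : leftDiv i (a * b) = leftDiv i a * b := by
  conv_lhs => rw [← sum_ι_mul_leftDiv ha, Finset.sum_mul, map_sum]
  simp [mul_assoc]

theorem leftDiv_mem {n : ℕ} {a : FreeTwo K} (ha : a ∈ homogeneousPart K (n + 1)) (i : Fin 2) :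
    leftDiv i a ∈ homogeneousPart K n := by
  have : homogeneousPart K (n + 1) ≤ (homogeneousPart K n).comap (leftDiv i) := by
    refine homogeneousPart_le fun w hw => ?_
    match w, hw with
    | j :: w, hw =>
      simp only [Submodule.mem_comap, monomialOf_cons, leftDiv_ι_mul]
      split_ifs
      · exact monomialOf_mem (by simpa using hw)
      · exact zero_mem _
  exact this ha

theorem reversal_mem {n : ℕ} {a : FreeTwo K} (ha : a ∈ homogeneousPart K n) :
    reversal a ∈ homogeneousPart K n := by
  have : homogeneousPart K n ≤ (homogeneousPart K n).comap reversal.toLinearMap := by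
    refine homogeneousPart_le fun w hw => ?_
    simp only [Submodule.mem_comap, LinearEquiv.coe_coe, reversal_monomialOf]
    exact monomialOf_mem (by simpa using hw)
  exact this ha

theorem leftDiv_rightDiv (i j : Fin 2) (a : FreeTwo K) :
    leftDiv i (rightDiv j a) = rightDiv j (leftDiv i a) := by
  have : (leftDiv i ∘ₗ rightDiv j : FreeTwo K →ₗ[K] FreeTwo K) = rightDiv j ∘ₗ leftDiv i := by
    refine ext_monomial fun w => ?_
    rcases w with _ | ⟨k, w⟩
    · simp
    · rcases List.eq_nil_or_concat w with rfl | ⟨t, l, rfl⟩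
      · have h1 := rightDiv_mul_ι (K := K) j k 1
        rw [one_mul] at h1
        have h2 := leftDiv_ι_mul (K := K) i k 1
        rw [mul_one] at h2
        simp [h1, h2]
        split_ifs <;> simp
      · simp only [List.concat_eq_append, LinearMap.comp_apply, monomialOf_cons, monomialOf_append,
          monomialOf_nil, mul_one, leftDiv_ι_mul]
        rw [← mul_assoc, rightDiv_mul_ι]
        split_ifs <;> simp [*]
  exact LinearMap.congr_fun this a

/-- The bilinear form for which the monomials are orthonormal. -/
noncomputable def pairing : FreeTwo K →ₗ[K] FreeTwo K →ₗ[K] K :=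
  (monomialBasis K).constr K fun w => (monomialBasis K).coord w

theorem pairing_monomialOf (u w : List (Fin 2)) :
    pairing (monomialOf K u) (monomialOf K w) = if u = w then 1 else 0 := by
  classical
  rw [pairing, ← monomialBasis_apply, Basis.constr_basis, ← monomialBasis_apply,
    Basis.coord_apply, Basis.repr_self, Finsupp.single_apply]
  simp only [eq_comm]

theorem pairing_comm (a b : FreeTwo K) : pairing a b = pairing b a := by
  have : (pairing : FreeTwo K →ₗ[K] FreeTwo K →ₗ[K] K) = pairing.flip :=
    ext_monomial fun u => ext_monomial fun w => by
      simp only [LinearMap.flip_apply, pairing_monomialOf, eq_comm]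
  exact LinearMap.congr_fun (LinearMap.congr_fun this a) b

/-- Division by a letter is adjoint to multiplication by it; this turns closure under quotients into
the ideal property of the orthogonal. -/
theorem pairing_ι_mul (i : Fin 2) (a b : FreeTwo K) :
    pairing (FreeAlgebra.ι K i * a) b = pairing a (leftDiv i b) := by
  have : (pairing ∘ₗ LinearMap.mulLeft K (FreeAlgebra.ι K i) :
      FreeTwo K →ₗ[K] FreeTwo K →ₗ[K] K) = (pairing.compl₂ (leftDiv i)) :=
    ext_monomial fun u => ext_monomial fun w => by
      simp only [LinearMap.comp_apply, LinearMap.mulLeft_apply, LinearMap.compl₂_apply,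
        ← monomialOf_cons, pairing_monomialOf, leftDiv_monomialOf]
      rcases w with _ | ⟨j, w⟩
      · simp
      · by_cases h : i = j
        · subst h; simp [pairing_monomialOf]
        · simp [h, Ne.symm h]
  exact LinearMap.congr_fun (LinearMap.congr_fun this a) b

theorem pairing_reversal (a b : FreeTwo K) :
    pairing (reversal a) b = pairing a (reversal b) := by
  have : (pairing ∘ₗ reversal.toLinearMap :
      FreeTwo K →ₗ[K] FreeTwo K →ₗ[K] K) = (pairing.compl₂ reversal.toLinearMap) :=
    ext_monomial fun u => ext_monomial fun w => by
      simp [reversal_monomialOf, pairing_monomialOf, List.reverse_eq_iff]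
  exact LinearMap.congr_fun (LinearMap.congr_fun this a) b

/-- Words split uniquely at a given position, so the form is multiplicative when the cuts agree.
Hence orthogonality in a single aligned segment makes whole products orthogonal. -/
theorem pairing_mul_mul {n : ℕ} {a c : FreeTwo K} (ha : a ∈ homogeneousPart K n)
    (hc : c ∈ homogeneousPart K n) (b d : FreeTwo K) :
    pairing (a * b) (c * d) = pairing a c * pairing b d := by
  induction n generalizing a c with
  | zero =>
    rw [homogeneousPart_zero, Submodule.mem_one] at ha hc
    obtain ⟨r, rfl⟩ := ha
    obtain ⟨s, rfl⟩ := hc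
    have h1 : pairing (1 : FreeTwo K) 1 = 1 := by simpa using pairing_monomialOf (K := K) [] []
    simp [Algebra.algebraMap_eq_smul_one, h1]
    ring
  | succ n ih =>
    rw [← sum_ι_mul_leftDiv ha]
    simp only [Finset.sum_mul, map_sum, LinearMap.sum_apply, mul_assoc, pairing_ι_mul]
    refine Finset.sum_congr rfl fun i _ => ?_
    rw [leftDiv_mul hc, ih (leftDiv_mem ha i) (leftDiv_mem hc i)]

theorem pairing_eq_zero {m n : ℕ} (h : m ≠ n) {a b : FreeTwo K} (ha : a ∈ homogeneousPart K m)
    (hb : b ∈ homogeneousPart K n) : pairing a b = 0 := by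
  have h1 : homogeneousPart K m ≤ LinearMap.ker (pairing.flip b) := by
    refine homogeneousPart_le fun u hu => ?_
    have h2 : homogeneousPart K n ≤ LinearMap.ker (pairing (monomialOf K u)) := by
      refine homogeneousPart_le fun w hw => ?_
      rw [LinearMap.mem_ker, pairing_monomialOf, if_neg]
      rintro rfl; omega
    exact h2 hb
  exact h1 ha

end Words

/-! ### Spaces of left and right quotients -/

section Quotients

variable {K : Type*} [Field K]

/-- The left quotients of the elements of `V` by the indeterminates. -/
noncomputable def leftQuot (V : Submodule K (FreeTwo K)) : Submodule K (FreeTwo K) :=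
  ⨆ i, V.map (leftDiv i)

/-- The right quotients of the elements of `V` by the indeterminates. -/
noncomputable def rightQuot (V : Submodule K (FreeTwo K)) : Submodule K (FreeTwo K) :=
  ⨆ i, V.map (rightDiv i)

variable {V W : Submodule K (FreeTwo K)}

theorem leftQuot_le (h : ∀ i, ∀ a ∈ V, leftDiv i a ∈ W) : leftQuot V ≤ W :=
  iSup_le fun i => Submodule.map_le_iff_le_comap.2 fun a ha => h i a ha

theorem leftDiv_mem_leftQuot {a : FreeTwo K} (ha : a ∈ V) (i : Fin 2) :
    leftDiv i a ∈ leftQuot V :=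
  (le_iSup (fun i => V.map (leftDiv i)) i) (Submodule.mem_map_of_mem ha)

theorem rightDiv_mem_rightQuot {a : FreeTwo K} (ha : a ∈ V) (i : Fin 2) :
    rightDiv i a ∈ rightQuot V :=
  (le_iSup (fun i => V.map (rightDiv i)) i) (Submodule.mem_map_of_mem ha)

theorem leftQuot_mono : Monotone (leftQuot (K := K)) := fun _ _ h =>
  iSup_mono fun _ => Submodule.map_mono h

theorem rightQuot_mono : Monotone (rightQuot (K := K)) := fun _ _ h =>
  iSup_mono fun _ => Submodule.map_mono h

theorem leftQuot_rightQuot (V : Submodule K (FreeTwo K)) :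
    leftQuot (rightQuot V) = rightQuot (leftQuot V) := by
  simp only [leftQuot, rightQuot, Submodule.map_iSup]
  rw [iSup_comm]
  simp only [← Submodule.map_comp]
  refine iSup_congr fun i => iSup_congr fun j => congrArg (fun f => Submodule.map f V) ?_
  exact LinearMap.ext fun a => leftDiv_rightDiv j i a

theorem leftQuot_rightQuot_iterate (a b : ℕ) (V : Submodule K (FreeTwo K)) :
    leftQuot^[a] (rightQuot^[b] V) = rightQuot^[b] (leftQuot^[a] V) :=
  (Function.Commute.iterate_iterate (f := leftQuot (K := K)) (g := rightQuot)
    leftQuot_rightQuot a b) V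

/-- The submodule of reversed elements. -/
noncomputable def reversed (V : Submodule K (FreeTwo K)) : Submodule K (FreeTwo K) :=
  V.map reversal.toLinearMap

theorem mem_reversed {a : FreeTwo K} : a ∈ reversed V ↔ reversal a ∈ V := by
  simp only [reversed, Submodule.mem_map, LinearEquiv.coe_coe]
  constructor
  · rintro ⟨b, hb, rfl⟩; simpa
  · intro h; exact ⟨_, h, by simp⟩

@[simp] theorem reversed_reversed (V : Submodule K (FreeTwo K)) : reversed (reversed V) = V := by
  ext; simp [mem_reversed]

theorem reversed_mono : Monotone (reversed (K := K)) := fun _ _ h => Submodule.map_mono h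

theorem reversed_mul_le (V W : Submodule K (FreeTwo K)) :
    reversed (V * W) ≤ reversed W * reversed V := by
  refine Submodule.map_le_iff_le_comap.2 (Submodule.mul_le.2 fun a ha b hb => ?_)
  simp only [Submodule.mem_comap, LinearEquiv.coe_coe, reversal_mul]
  exact Submodule.mul_mem_mul (Submodule.mem_map_of_mem hb) (Submodule.mem_map_of_mem ha)

theorem reversed_mul (V W : Submodule K (FreeTwo K)) :
    reversed (V * W) = reversed W * reversed V := by
  refine le_antisymm (reversed_mul_le V W) ?_
  have := reversed_mono (reversed_mul_le (reversed W) (reversed V))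
  simpa using this

@[simp] theorem reversed_homogeneousPart (n : ℕ) :
    reversed (homogeneousPart K n) = homogeneousPart K n := by
  ext a
  rw [mem_reversed]
  exact ⟨fun h => by simpa using reversal_mem h, reversal_mem⟩

theorem reversed_le_homogeneousPart {n : ℕ} (h : V ≤ homogeneousPart K n) :
    reversed V ≤ homogeneousPart K n := by
  simpa using reversed_mono h

theorem rightQuot_eq (V : Submodule K (FreeTwo K)) :
    rightQuot V = reversed (leftQuot (reversed V)) := by
  simp only [leftQuot, rightQuot, reversed, Submodule.map_iSup, ← Submodule.map_comp]
  rfl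

theorem rightQuot_iterate_eq (n : ℕ) (V : Submodule K (FreeTwo K)) :
    rightQuot^[n] V = reversed (leftQuot^[n] (reversed V)) := by
  induction n with
  | zero => simp
  | succ n ih => rw [Function.iterate_succ_apply', ih, rightQuot_eq, reversed_reversed,
      Function.iterate_succ_apply']

theorem leftQuot_iterate_mono (n : ℕ) : Monotone (leftQuot (K := K))^[n] :=
  leftQuot_mono.iterate n

theorem rightQuot_iterate_mono (n : ℕ) : Monotone (rightQuot (K := K))^[n] :=
  rightQuot_mono.iterate n

theorem leftQuot_homogeneousPart {n : ℕ} (h : V ≤ homogeneousPart K (n + 1)) :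
    leftQuot V ≤ homogeneousPart K n :=
  leftQuot_le fun i _ ha => leftDiv_mem (h ha) i

theorem leftQuot_iterate_homogeneousPart {a n : ℕ} (h : V ≤ homogeneousPart K (n + a)) :
    leftQuot^[a] V ≤ homogeneousPart K n := by
  induction a generalizing V with
  | zero => simpa using h
  | succ a ih => exact ih (leftQuot_homogeneousPart (by rwa [add_assoc]))

theorem rightQuot_iterate_homogeneousPart {a n : ℕ} (h : V ≤ homogeneousPart K (n + a)) :
    rightQuot^[a] V ≤ homogeneousPart K n := by
  rw [rightQuot_iterate_eq]
  exact reversed_le_homogeneousPart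
    (leftQuot_iterate_homogeneousPart (reversed_le_homogeneousPart h))

theorem leftQuot_iterate_eq_bot {a n : ℕ} (h : V ≤ homogeneousPart K n) (ha : n < a) :
    leftQuot^[a] V = ⊥ := by
  obtain ⟨b, rfl⟩ := Nat.exists_eq_add_of_lt ha
  have h1 : leftQuot^[n] V ≤ homogeneousPart K 0 :=
    leftQuot_iterate_homogeneousPart (by simpa using h)
  have h2 : ∀ b, leftQuot^[b] (⊥ : Submodule K (FreeTwo K)) = ⊥ := fun b =>
    Function.iterate_fixed (by simp [leftQuot]) b
  rw [show n + b + 1 = b + (1 + n) by ring, Function.iterate_add_apply,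
    Function.iterate_add_apply, ← h2 b]
  congr 1
  -- After `n` quotients only constants are left, and one further division kills these.
  refine le_bot_iff.1 (leftQuot_le fun i a ha => ?_)
  have := h1 ha
  rw [homogeneousPart_zero, Submodule.mem_one] at this
  obtain ⟨r, rfl⟩ := this
  simp [Algebra.algebraMap_eq_smul_one]

theorem rightQuot_iterate_eq_bot {a n : ℕ} (h : V ≤ homogeneousPart K n) (ha : n < a) :
    rightQuot^[a] V = ⊥ := by
  rw [rightQuot_iterate_eq, leftQuot_iterate_eq_bot (reversed_le_homogeneousPart h) ha]
  simp [reversed]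

theorem leftQuot_mul_le {n : ℕ} (h : V ≤ homogeneousPart K (n + 1))
    (W : Submodule K (FreeTwo K)) : leftQuot (V * W) ≤ leftQuot V * W := by
  refine iSup_le fun i => Submodule.map_le_iff_le_comap.2 (Submodule.mul_le.2 fun a ha b hb => ?_)
  rw [Submodule.mem_comap, leftDiv_mul (h ha)]
  exact Submodule.mul_mem_mul (leftDiv_mem_leftQuot ha i) hb

theorem leftQuot_iterate_mul_le {a n : ℕ} (h : V ≤ homogeneousPart K n) (ha : a ≤ n)
    (W : Submodule K (FreeTwo K)) : leftQuot^[a] (V * W) ≤ leftQuot^[a] V * W := by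
  induction a generalizing V n with
  | zero => simp
  | succ a ih =>
    obtain ⟨n, rfl⟩ : ∃ m, n = m + 1 := ⟨n - 1, by omega⟩
    exact (leftQuot_iterate_mono a (leftQuot_mul_le h W)).trans
      (ih (leftQuot_homogeneousPart h) (by omega))

theorem rightQuot_iterate_mul_le {a n : ℕ} (V : Submodule K (FreeTwo K))
    (h : W ≤ homogeneousPart K n) (ha : a ≤ n) :
    rightQuot^[a] (V * W) ≤ V * rightQuot^[a] W := by
  simp only [rightQuot_iterate_eq, reversed_mul]
  have := reversed_mono (leftQuot_iterate_mul_le (reversed_le_homogeneousPart h) ha (reversed V))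
  rwa [reversed_mul, reversed_reversed] at this

/-- The first `n` quotients consume `V` entirely and leave constants times `W`. -/
theorem leftQuot_iterate_mul_le_right {a n : ℕ} (h : V ≤ homogeneousPart K n)
    (W : Submodule K (FreeTwo K)) : leftQuot^[a + n] (V * W) ≤ leftQuot^[a] W := by
  rw [Function.iterate_add_apply]
  refine leftQuot_iterate_mono a ((leftQuot_iterate_mul_le h le_rfl W).trans ?_)
  have h1 : leftQuot^[n] V ≤ homogeneousPart K 0 :=
    leftQuot_iterate_homogeneousPart (by simpa using h)
  rw [homogeneousPart_zero] at h1
  simpa using mul_le_mul' h1 (le_refl W)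

theorem rightQuot_iterate_mul_le_left {a n : ℕ} (V : Submodule K (FreeTwo K))
    (h : W ≤ homogeneousPart K n) : rightQuot^[a + n] (V * W) ≤ rightQuot^[a] V := by
  simp only [rightQuot_iterate_eq, reversed_mul]
  exact reversed_mono (leftQuot_iterate_mul_le_right (reversed_le_homogeneousPart h) _)

theorem le_homogeneousPart_one_mul_leftQuot {n : ℕ} (h : V ≤ homogeneousPart K (n + 1)) :
    V ≤ homogeneousPart K 1 * leftQuot V := fun a ha => by
  rw [← sum_ι_mul_leftDiv (h ha)]
  exact Submodule.sum_mem _ fun i _ => Submodule.mul_mem_mul (ι_mem i) (leftDiv_mem_leftQuot ha i)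

theorem le_rightQuot_mul_homogeneousPart_one {n : ℕ} (h : V ≤ homogeneousPart K (n + 1)) :
    V ≤ rightQuot V * homogeneousPart K 1 := by
  have := reversed_mono (le_homogeneousPart_one_mul_leftQuot (reversed_le_homogeneousPart h))
  simpa [reversed_mul, ← rightQuot_eq] using this

theorem pow_le_homogeneousPart {n : ℕ} (h : V ≤ homogeneousPart K n) (t : ℕ) :
    V ^ t ≤ homogeneousPart K (t * n) := by
  rw [← homogeneousPart_pow]
  exact pow_le_pow_left' h t

theorem mul_le_homogeneousPart {m n : ℕ} (hV : V ≤ homogeneousPart K m)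
    (hW : W ≤ homogeneousPart K n) : V * W ≤ homogeneousPart K (m + n) := by
  rw [← homogeneousPart_mul]
  exact mul_le_mul' hV hW

/-- Right quotients of a power: whole factors disappear first. -/
theorem rightQuot_pow_le {N r : ℕ} (h : V ≤ homogeneousPart K N) (hr : r ≤ N) (s i : ℕ) :
    rightQuot^[r + i * N] (V ^ (s + 1 + i)) ≤ V ^ s * rightQuot^[r] V := by
  rw [pow_add]
  refine (rightQuot_iterate_mul_le_left _ (pow_le_homogeneousPart h i)).trans ?_
  rw [pow_succ]
  exact rightQuot_iterate_mul_le _ h hr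

/-- Mirror image of `rightQuot_pow_le`: `i` factors erased, one truncated, `s` untouched. -/
theorem leftQuot_pow_le {N r : ℕ} (h : V ≤ homogeneousPart K N) (hr : r ≤ N) (s i : ℕ) :
    leftQuot^[r + i * N] (V ^ (i + (1 + s))) ≤ leftQuot^[r] V * V ^ s := by
  rw [pow_add]
  refine (leftQuot_iterate_mul_le_right (pow_le_homogeneousPart h i) _).trans ?_
  rw [pow_add, pow_one]
  exact leftQuot_iterate_mul_le h hr _

end Quotients

/-! ### Dimension bounds through spanning sets -/

section SpannedBy

/-- `V` is contained in the span of at most `d` elements. -/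
def SpannedBy {K M : Type*} [Field K] [AddCommGroup M] [Module K M] (V : Submodule K M) (d : ℕ) :
    Prop :=
  ∃ S : Finset M, S.card ≤ d ∧ V ≤ Submodule.span K S

namespace SpannedBy

variable {K M : Type*} [Field K] [AddCommGroup M] [Module K M] {V W : Submodule K M} {d e : ℕ}

theorem mono (h : SpannedBy V d) (hW : W ≤ V) (hd : d ≤ e) : SpannedBy W e :=
  let ⟨S, hS, hV⟩ := h
  ⟨S, hS.trans hd, hW.trans hV⟩

theorem bot : SpannedBy (⊥ : Submodule K M) d := ⟨∅, by simp, bot_le⟩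

theorem span (S : Finset M) : SpannedBy (Submodule.span K (S : Set M)) S.card :=
  ⟨S, le_rfl, le_rfl⟩

theorem sup (hV : SpannedBy V d) (hW : SpannedBy W e) : SpannedBy (V ⊔ W) (d + e) := by
  classical
  obtain ⟨S, hS, hV⟩ := hV
  obtain ⟨T, hT, hW⟩ := hW
  refine ⟨S ∪ T, (Finset.card_union_le _ _).trans (by omega), ?_⟩
  rw [Finset.coe_union, Submodule.span_union]
  exact sup_le_sup hV hW

theorem finsetSup {α : Type*} (s : Finset α) (f : α → Submodule K M)
    (h : ∀ i ∈ s, SpannedBy (f i) d) : SpannedBy (s.sup f) (s.card * d) := by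
  classical
  induction s using Finset.induction_on with
  | empty => simpa using bot
  | insert a s ha ih =>
    rw [Finset.sup_insert, Finset.card_insert_of_notMem ha]
    exact ((h a (by simp)).sup (ih fun i hi => h i (by simp [hi]))).mono le_rfl (by linarith)

theorem iSup {α : Type*} [Fintype α] (f : α → Submodule K M)
    (h : ∀ i, SpannedBy (f i) d) : SpannedBy (⨆ i, f i) (Fintype.card α * d) := by
  rw [← Finset.sup_univ_eq_iSup]
  exact finsetSup _ _ fun i _ => h i

theorem map {M' : Type*} [AddCommGroup M'] [Module K M'] (h : SpannedBy V d) (f : M →ₗ[K] M') :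
    SpannedBy (V.map f) d := by
  classical
  obtain ⟨S, hS, hV⟩ := h
  refine ⟨S.image f, Finset.card_image_le.trans hS, ?_⟩
  rw [Finset.coe_image, ← Submodule.map_span]
  exact Submodule.map_mono hV

theorem finite (h : SpannedBy V d) : Module.Finite K V := by
  obtain ⟨S, hS, hV⟩ := h
  have : FiniteDimensional K (Submodule.span K (S : Set M)) := FiniteDimensional.span_finset K S
  exact Submodule.finiteDimensional_of_le hV

theorem finrank_le (h : SpannedBy V d) : Module.finrank K V ≤ d := by
  obtain ⟨S, hS, hV⟩ := h
  have : FiniteDimensional K (Submodule.span K (S : Set M)) := FiniteDimensional.span_finset K S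
  exact (Submodule.finrank_mono hV).trans ((finrank_span_finset_le_card S).trans hS)

theorem of_finrank [Module.Finite K V] (h : Module.finrank K V ≤ d) : SpannedBy V d := by
  classical
  let b := Module.finBasis K V
  refine ⟨Finset.univ.image fun i => (b i : M),
    Finset.card_image_le.trans (by simpa using h), ?_⟩
  have h1 : Submodule.map V.subtype (Submodule.span K (Set.range b)) = V := by
    rw [b.span_eq, Submodule.map_top, Submodule.range_subtype]
  rw [Submodule.map_span] at h1
  refine h1.ge.trans (Submodule.span_mono ?_)
  rintro _ ⟨_, ⟨i, rfl⟩, rfl⟩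
  simp

theorem mul {A : Type*} [Ring A] [Algebra K A] {V W : Submodule K A} (hV : SpannedBy V d)
    (hW : SpannedBy W e) : SpannedBy (V * W) (d * e) := by
  classical
  obtain ⟨S, hS, hV⟩ := hV
  obtain ⟨T, hT, hW⟩ := hW
  refine ⟨Finset.image₂ (· * ·) S T, (Finset.card_image₂_le _ _ _).trans
    (Nat.mul_le_mul hS hT), ?_⟩
  refine (mul_le_mul' hV hW).trans ?_
  rw [Submodule.span_mul_span, Finset.coe_image₂, Set.image2_mul]

theorem pow {A : Type*} [Ring A] [Algebra K A] {V : Submodule K A} (hV : SpannedBy V d) (n : ℕ) :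
    SpannedBy (V ^ n) (d ^ n) := by
  classical
  induction n with
  | zero => exact ⟨{1}, by simp, by simp [Submodule.one_eq_span]⟩
  | succ n ih => rw [pow_succ, pow_succ]; exact ih.mul hV

theorem _root_.spannedBy_homogeneousPart (n : ℕ) : SpannedBy (homogeneousPart K n) (2 ^ n) := by
  classical
  have h : SpannedBy (homogeneousPart K 1) 2 := by
    refine ⟨{FreeAlgebra.ι K 0, FreeAlgebra.ι K 1}, Finset.card_le_two, homogeneousPart_le ?_⟩
    rintro w hw
    obtain ⟨i, rfl⟩ := List.length_eq_one_iff.1 hw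
    refine Submodule.subset_span ?_
    fin_cases i <;> simp
  have := h.pow n
  rwa [homogeneousPart_pow, mul_one] at this

theorem iterate_leftQuot {V : Submodule K (FreeTwo K)} (h : SpannedBy V d) (n : ℕ) :
    SpannedBy (leftQuot^[n] V) (2 ^ n * d) := by
  induction n with
  | zero => simpa using h
  | succ n ih =>
    rw [Function.iterate_succ_apply']
    refine (SpannedBy.iSup _ fun i => ih.map (leftDiv i)).mono le_rfl ?_
    rw [Fintype.card_fin, pow_succ']; ring_nf; exact le_rfl

theorem reverse {V : Submodule K (FreeTwo K)} (h : SpannedBy V d) : SpannedBy (reversed V) d :=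
  h.map _

theorem iterate_rightQuot {V : Submodule K (FreeTwo K)} (h : SpannedBy V d) (n : ℕ) :
    SpannedBy (rightQuot^[n] V) (2 ^ n * d) := by
  rw [rightQuot_iterate_eq]
  exact (h.reverse.iterate_leftQuot n).reverse

end SpannedBy

end SpannedBy

/-! ### Spaces containing all factors of a given degree -/

section Factors

variable {K : Type*} [Field K] {V W G X P : Submodule K (FreeTwo K)}

/-- The factors of degree `n` of the elements of `V` (which are homogeneous of degree `N`) lie in
a space spanned by `d` elements. -/
def FactorsSpannedBy (V : Submodule K (FreeTwo K)) (N n d : ℕ) : Prop :=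
  ∃ B : Submodule K (FreeTwo K), SpannedBy B d ∧
    ∀ a b, a + b + n = N → leftQuot^[a] (rightQuot^[b] V) ≤ B

/-- A factor longer than one block is a tail of a block, a run of whole blocks and a head of a
block. Its shape depends only on the offset `r < N` of its start within a block, so `N` products
suffice. -/
theorem FactorsSpannedBy.pow {N n M g : ℕ} (hG : G ≤ homogeneousPart K N) (hn : N < n)
    (hN : 0 < N) (hl : ∀ r, SpannedBy (leftQuot^[r] G) M) (hr : ∀ r, SpannedBy (rightQuot^[r] G) M)
    (hg : SpannedBy G g) (hg1 : 1 ≤ g) (t : ℕ) :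
    FactorsSpannedBy (G ^ t) (t * N) n (N * (M * g ^ t * M)) := by
  classical
  -- `q r` counts the whole blocks: if `r' < N` letters are missing at the other end, then `r + r' +
  -- n = (q r + 2) * N`. Offsets with `q r > t` do not occur; they get `⊥` so that the bound `g ^ t`
  -- survives.
  let q : ℕ → ℕ := fun r => (n + r - 1) / N - 1
  refine ⟨(Finset.range N).sup fun r => if q r ≤ t then
    leftQuot^[r] G * G ^ (q r) * rightQuot^[(q r + 2) * N - n - r] G else ⊥, ?_, ?_⟩
  · have := SpannedBy.finsetSup (d := M * g ^ t * M) (Finset.range N) (fun r => if q r ≤ t then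
      leftQuot^[r] G * G ^ (q r) * rightQuot^[(q r + 2) * N - n - r] G else ⊥) ?_
    · simpa using this
    · intro r _
      split_ifs with h
      · exact (((hl r).mul (hg.pow _)).mul (hr _)).mono le_rfl
          (Nat.mul_le_mul_right _ (Nat.mul_le_mul_left _ (Nat.pow_le_pow_right hg1 h)))
      · exact SpannedBy.bot
  · intro a b hab
    obtain ⟨i, r, hr', rfl⟩ : ∃ i r, r < N ∧ a = r + i * N :=
      ⟨a / N, a % N, Nat.mod_lt _ hN, by rw [mul_comm]; exact (Nat.mod_add_div _ _).symm⟩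
    obtain ⟨i', r', hr'', rfl⟩ : ∃ i r, r < N ∧ b = r + i * N :=
      ⟨b / N, b % N, Nat.mod_lt _ hN, by rw [mul_comm]; exact (Nat.mod_add_div _ _).symm⟩
    have h1 : i + i' + 1 < t := by
      by_contra hcon
      have : t * N ≤ (i + i' + 1) * N := Nat.mul_le_mul_right _ (by omega)
      have e1 : (i + i' + 1) * N = i * N + i' * N + N := by ring
      omega
    obtain ⟨p, rfl⟩ : ∃ p, t = i + i' + 2 + p := ⟨t - (i + i' + 2), by omega⟩
    have e2 : (i + i' + 2 + p) * N = i * N + i' * N + (p + 2) * N := by ring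
    have e3 : r + r' + n = (p + 2) * N := by omega
    have hq : q r = p := by
      have : (n + r - 1) / N = p + 1 := by
        refine Nat.div_eq_of_lt_le ?_ ?_
        · have : (p + 2) * N = (p + 1) * N + N := by ring
          omega
        · have : (p + 1 + 1) * N = (p + 2) * N := by ring
          omega
      simp [q, this]
    refine le_trans ?_ (Finset.le_sup (Finset.mem_range.2 hr'))
    rw [hq, if_pos (by omega), show (p + 2) * N - n - r = r' by omega]
    have h2 : rightQuot^[r' + i' * N] (G ^ (i + i' + 2 + p)) ≤
        G ^ (i + (1 + p)) * rightQuot^[r'] G := by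
      rw [show i + i' + 2 + p = i + (1 + p) + 1 + i' by ring]
      exact rightQuot_pow_le hG hr''.le _ _
    refine (leftQuot_iterate_mono _ h2).trans ?_
    refine (leftQuot_iterate_mul_le (pow_le_homogeneousPart hG _) ?_ _).trans ?_
    · have : (i + (1 + p)) * N = i * N + N + p * N := by ring
      rw [this]
      have := Nat.zero_le (p * N)
      omega
    · exact mul_le_mul' (leftQuot_pow_le hG hr'.le _ _) le_rfl

/-- A factor lies inside `V`, inside `W`, or straddles the cut. In the last case it is a tail of `V`
times a head of `W`, and the number of its letters in `V` takes at most `n + 1` values. -/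
theorem FactorsSpannedBy.mul {p q n d₁ d₂ s u : ℕ} (hV : V ≤ homogeneousPart K p)
    (hW : W ≤ homogeneousPart K q) (h₁ : FactorsSpannedBy V p n d₁)
    (h₂ : FactorsSpannedBy W q n d₂) (hs : ∀ a, SpannedBy (leftQuot^[a] V) s)
    (hu : ∀ b, SpannedBy (rightQuot^[b] W) u) :
    FactorsSpannedBy (V * W) (p + q) n (d₁ + d₂ + (n + 1) * (s * u)) := by
  obtain ⟨B₁, hB₁, h₁⟩ := h₁
  obtain ⟨B₂, hB₂, h₂⟩ := h₂
  refine ⟨B₁ ⊔ B₂ ⊔ (Finset.range (n + 1)).sup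
    fun i => leftQuot^[p - i] V * rightQuot^[q - (n - i)] W, (hB₁.sup hB₂).sup ?_, ?_⟩
  · have := SpannedBy.finsetSup (d := s * u) (Finset.range (n + 1))
      (fun i => leftQuot^[p - i] V * rightQuot^[q - (n - i)] W) fun i _ => (hs _).mul (hu _)
    simpa using this
  · intro a b hab
    rcases lt_or_ge p a with ha | ha
    · refine le_trans ?_ (le_sup_of_le_left le_sup_right)
      refine le_trans ?_ (h₂ (a - p) b (by omega))
      refine (leftQuot_iterate_mono _ (rightQuot_iterate_mul_le V hW (by omega))).trans ?_
      have := leftQuot_iterate_mul_le_right (a := a - p) hV (rightQuot^[b] W)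
      rwa [Nat.sub_add_cancel ha.le] at this
    · rcases lt_or_ge q b with hb | hb
      · refine le_trans ?_ (le_sup_of_le_left le_sup_left)
        refine le_trans ?_ (h₁ a (b - q) (by omega))
        have := rightQuot_iterate_mul_le_left (a := b - q) V hW
        rw [Nat.sub_add_cancel hb.le] at this
        exact leftQuot_iterate_mono _ this
      · refine le_trans ?_ le_sup_right
        refine le_trans ?_ (Finset.le_sup (b := p - a) (Finset.mem_range.2 (by omega)))
        rw [show p - (p - a) = a by omega, show q - (n - (p - a)) = b by omega]
        refine (leftQuot_iterate_mono _ (rightQuot_iterate_mul_le V hW hb)).trans ?_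
        exact leftQuot_iterate_mul_le hV ha _

theorem FactorsSpannedBy.mono {N n d e : ℕ} (h : FactorsSpannedBy V N n d) (hW : W ≤ V)
    (hd : d ≤ e) : FactorsSpannedBy W N n e :=
  let ⟨B, hB, h⟩ := h
  ⟨B, hB.mono le_rfl hd, fun a b hab =>
    (leftQuot_iterate_mono a (rightQuot_iterate_mono b hW)).trans (h a b hab)⟩

/-- The factors of degree at most `N` of the powers of `G` only involve one or two factors `G`. -/
theorem FactorsSpannedBy.pow_of_le {N n d D : ℕ} (hG : G ≤ homogeneousPart K N) (hn : n ≤ N)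
    (hn0 : 0 < n) (h : FactorsSpannedBy G N n d) (hl : ∀ a, SpannedBy (leftQuot^[a] G) D)
    (hr : ∀ b, SpannedBy (rightQuot^[b] G) D) :
    ∃ B : Submodule K (FreeTwo K), SpannedBy B (d + (n + 1) * (D * D)) ∧
      ∀ t a b, a + b + n = t * N → leftQuot^[a] (rightQuot^[b] (G ^ t)) ≤ B := by
  obtain ⟨B, hB, h⟩ := h
  refine ⟨B ⊔ (Finset.range (n + 1)).sup
    fun i => leftQuot^[N - i] G * rightQuot^[N - (n - i)] G, hB.sup ?_, ?_⟩
  · have := SpannedBy.finsetSup (d := D * D) (Finset.range (n + 1))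
      (fun i => leftQuot^[N - i] G * rightQuot^[N - (n - i)] G) fun i _ => (hl _).mul (hr _)
    simpa using this
  · intro t a b hab
    obtain ⟨i, r, hr', rfl⟩ : ∃ i r, r < N ∧ a = r + i * N :=
      ⟨a / N, a % N, Nat.mod_lt _ (by omega), by rw [mul_comm]; exact (Nat.mod_add_div _ _).symm⟩
    have hit : i < t := by
      by_contra hcon
      have : t * N ≤ i * N := Nat.mul_le_mul_right _ (by omega)
      omega
    rw [leftQuot_rightQuot_iterate]
    obtain ⟨s, rfl⟩ : ∃ s, t = i + (1 + s) := ⟨t - i - 1, by omega⟩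
    have e1 : (i + (1 + s)) * N = i * N + N + s * N := by ring
    refine (rightQuot_iterate_mono _ (leftQuot_pow_le hG hr'.le _ _)).trans ?_
    have hlG : leftQuot^[r] G ≤ homogeneousPart K (N - r) :=
      leftQuot_iterate_homogeneousPart (by rwa [Nat.sub_add_cancel hr'.le])
    -- As `n ≤ N`, the factor ends in the block where it starts or in the next one.
    rcases le_or_gt (r + n) N with hrn | hrn
    · refine le_trans ?_ le_sup_left
      refine le_trans ?_ (h r (b - s * N) (by omega))
      rw [leftQuot_rightQuot_iterate]
      have := rightQuot_iterate_mul_le_left (a := b - s * N) (leftQuot^[r] G)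
        (pow_le_homogeneousPart hG s)
      rwa [Nat.sub_add_cancel (by omega)] at this
    · obtain ⟨s, rfl⟩ : ∃ m, s = 1 + m := by
        refine ⟨s - 1, ?_⟩
        rcases Nat.eq_zero_or_pos s with rfl | hs
        · omega
        · omega
      have e2 : (1 + s) * N = N + s * N := by ring
      refine le_trans ?_ le_sup_right
      refine le_trans ?_ (Finset.le_sup (b := N - r) (Finset.mem_range.2 (by omega)))
      rw [show N - (N - r) = r by omega, show N - (n - (N - r)) = b - s * N by omega, pow_add,
        ← mul_assoc, pow_one]
      have := rightQuot_iterate_mul_le_left (a := b - s * N) (leftQuot^[r] G * G)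
        (pow_le_homogeneousPart hG s)
      rw [Nat.sub_add_cancel (by omega)] at this
      exact this.trans (rightQuot_iterate_mul_le _ hG (by omega))

/-- A quotient of a power of a line is a tail of one factor followed by whole factors, which
contribute dimension one. The bound is therefore independent of `e`, which leaves the exponents of
the construction free. -/
theorem SpannedBy.leftQuot_pow {N M : ℕ} (hX : X ≤ homogeneousPart K N) (hN : 0 < N)
    (hX1 : SpannedBy X 1) (h : ∀ a, SpannedBy (leftQuot^[a] X) M) (hM : 1 ≤ M) (e a : ℕ) :
    SpannedBy (leftQuot^[a] (X ^ e)) M := by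
  rcases lt_or_ge (e * N) a with ha | ha
  · rw [leftQuot_iterate_eq_bot (pow_le_homogeneousPart hX e) ha]; exact .bot
  rcases Nat.eq_zero_or_pos a with rfl | ha0
  · exact (hX1.pow e).mono le_rfl (by simpa using hM)
  obtain ⟨i, r, hr, rfl⟩ : ∃ i r, r ≤ N ∧ a = r + i * N := by
    refine ⟨(a - 1) / N, (a - 1) % N + 1, Nat.mod_lt _ hN, ?_⟩
    have := Nat.mod_add_div (a - 1) N
    rw [mul_comm] at this
    omega
  by_cases hi : i < e
  · obtain ⟨s, rfl⟩ : ∃ s, e = i + (1 + s) := ⟨e - i - 1, by omega⟩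
    exact ((h r).mul (hX1.pow s)).mono (leftQuot_pow_le hX hr _ _) (by simp)
  · have : e * N ≤ i * N := Nat.mul_le_mul_right _ (by omega)
    obtain rfl : r = 0 := by omega
    have h2 : e * N = i * N := by omega
    have : leftQuot^[0 + i * N] (X ^ e) ≤ homogeneousPart K 0 :=
      leftQuot_iterate_homogeneousPart (by rw [zero_add, zero_add, ← h2]; exact pow_le_homogeneousPart hX e)
    exact (spannedBy_homogeneousPart 0).mono this (by simpa using hM)

theorem reversed_pow (V : Submodule K (FreeTwo K)) (n : ℕ) : reversed (V ^ n) = reversed V ^ n := by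
  induction n with
  | zero => rw [pow_zero, pow_zero, ← homogeneousPart_zero, reversed_homogeneousPart]
  | succ n ih => rw [pow_succ, reversed_mul, ih, pow_succ']

theorem SpannedBy.leftQuot_reversed {M a : ℕ} (h : SpannedBy (rightQuot^[a] V) M) :
    SpannedBy (leftQuot^[a] (reversed V)) M := by
  rw [rightQuot_iterate_eq] at h
  simpa using h.reverse

theorem SpannedBy.rightQuot_reversed {M a : ℕ} (h : SpannedBy (leftQuot^[a] V) M) :
    SpannedBy (rightQuot^[a] (reversed V)) M := by
  rw [rightQuot_iterate_eq, reversed_reversed]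
  exact h.reverse

theorem SpannedBy.rightQuot_pow {N M : ℕ} (hX : X ≤ homogeneousPart K N) (hN : 0 < N)
    (hX1 : SpannedBy X 1) (h : ∀ a, SpannedBy (rightQuot^[a] X) M) (hM : 1 ≤ M) (e a : ℕ) :
    SpannedBy (rightQuot^[a] (X ^ e)) M := by
  have := SpannedBy.leftQuot_pow (reversed_le_homogeneousPart hX) hN hX1.reverse
    (fun a => (h a).leftQuot_reversed) hM e a
  rw [rightQuot_iterate_eq, reversed_pow]
  exact this.reverse

end Factors

/-! ### Substitution of a pair of homogeneous polynomials -/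

section Substitution

variable {K : Type*} [Field K] {V G P : Submodule K (FreeTwo K)} {g : Fin 2 → FreeTwo K}

/-- Substitution of `g 0` and `g 1` for the indeterminates. -/
noncomputable def substitute (g : Fin 2 → FreeTwo K) : FreeTwo K →ₐ[K] FreeTwo K :=
  FreeAlgebra.lift K g

@[simp] theorem substitute_ι (i : Fin 2) : substitute g (FreeAlgebra.ι K i) = g i := by
  simp [substitute]

theorem map_substitute_one_le (hg : ∀ i, g i ∈ G) :
    (homogeneousPart K 1).map (substitute g).toLinearMap ≤ G := by
  refine Submodule.map_le_iff_le_comap.2 (homogeneousPart_le fun w hw => ?_)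
  obtain ⟨i, rfl⟩ := List.length_eq_one_iff.1 hw
  simpa using hg i

theorem map_substitute_le {n : ℕ} (hg : ∀ i, g i ∈ G) (hV : V ≤ homogeneousPart K n) :
    V.map (substitute g).toLinearMap ≤ G ^ n := by
  refine (Submodule.map_mono hV).trans ?_
  have : homogeneousPart K n = homogeneousPart K 1 ^ n := by simp [homogeneousPart_pow]
  rw [this, Submodule.map_pow]
  exact pow_le_pow_left' (map_substitute_one_le hg) n

theorem map_substitute_le_mul {n : ℕ} (hg : ∀ i, g i ∈ G) (hV : V ≤ homogeneousPart K (n + 1)) :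
    V.map (substitute g).toLinearMap ≤ (rightQuot V).map (substitute g).toLinearMap * G := by
  refine (Submodule.map_mono (le_rightQuot_mul_homogeneousPart_one hV)).trans ?_
  rw [Submodule.map_mul]
  exact mul_le_mul' le_rfl (map_substitute_one_le hg)

/-- Each letter of the pattern becomes a polynomial of degree `N`, so `N` quotients undo one
substituted letter. -/
theorem rightQuot_map_substitute_le {N n s : ℕ} (hG : G ≤ homogeneousPart K N)
    (hg : ∀ i, g i ∈ G) (hV : V ≤ homogeneousPart K n) (hs : s ≤ n) :
    rightQuot^[s * N] (V.map (substitute g).toLinearMap) ≤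
      (rightQuot^[s] V).map (substitute g).toLinearMap := by
  induction s with
  | zero => simp
  | succ s ih =>
    have h1 : rightQuot^[s] V ≤ homogeneousPart K (n - s - 1 + 1) :=
      rightQuot_iterate_homogeneousPart (by rwa [show n - s - 1 + 1 + s = n by omega])
    rw [show (s + 1) * N = N + s * N by ring, Function.iterate_add_apply,
      Function.iterate_succ_apply']
    refine (rightQuot_iterate_mono N ((ih (by omega)).trans (map_substitute_le_mul hg h1))).trans ?_
    simpa using rightQuot_iterate_mul_le_left (a := 0)
      ((rightQuot (rightQuot^[s] V)).map (substitute g).toLinearMap) hG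

/-- A right quotient of `P` by `s` letters out of `2γ` is spanned by few elements both if
`s` is small and if `s` is large. -/
theorem SpannedBy.rightQuot_map_substitute {N M γ : ℕ} (hG : G ≤ homogeneousPart K N) (hN : 0 < N)
    (hg : ∀ i, g i ∈ G) (hr : ∀ r, SpannedBy (rightQuot^[r] G) M) (hM : 1 ≤ M)
    (hP : P ≤ homogeneousPart K (2 * γ)) (hP2 : SpannedBy P 2) (b : ℕ) :
    SpannedBy (rightQuot^[b] (P.map (substitute g).toLinearMap)) (2 ^ (γ + 1) * M) := by
  have hH : P.map (substitute g).toLinearMap ≤ homogeneousPart K (2 * γ * N) :=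
    (map_substitute_le hg hP).trans (pow_le_homogeneousPart hG _)
  rcases lt_or_ge (2 * γ * N) b with hb | hb
  · rw [rightQuot_iterate_eq_bot hH hb]; exact .bot
  obtain ⟨s, r, hr', rfl⟩ : ∃ i r, r < N ∧ b = r + i * N :=
    ⟨b / N, b % N, Nat.mod_lt _ hN, by rw [mul_comm]; exact (Nat.mod_add_div _ _).symm⟩
  by_cases hs : s < 2 * γ
  · have h1 : rightQuot^[s] P ≤ homogeneousPart K (2 * γ - s - 1 + 1) :=
      rightQuot_iterate_homogeneousPart (by rwa [show 2 * γ - s - 1 + 1 + s = 2 * γ by omega])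
    have h2 : rightQuot^[r + s * N] (P.map (substitute g).toLinearMap) ≤
        (rightQuot^[s + 1] P).map (substitute g).toLinearMap * rightQuot^[r] G := by
      rw [Function.iterate_add_apply, Function.iterate_succ_apply']
      refine (rightQuot_iterate_mono r ((rightQuot_map_substitute_le hG hg hP hs.le).trans
        (map_substitute_le_mul hg h1))).trans ?_
      exact rightQuot_iterate_mul_le _ hG hr'.le
    refine (SpannedBy.mul ?_ (hr r)).mono h2 le_rfl
    refine SpannedBy.map ?_ _
    -- Up to `γ` letters removed, each removal at most doubles the dimension; beyond that, fewer
    -- than `γ` letters remain. The loss is about `2 ^ γ` instead of `2 ^ (2 * γ)`, so that its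
    -- square is still of order `2 ^ (2 * γ)`.
    rcases le_or_gt (s + 1) γ with h | h
    · refine (hP2.iterate_rightQuot (s + 1)).mono le_rfl ?_
      rw [← pow_succ]
      exact Nat.pow_le_pow_right (by omega) (by omega)
    · refine (spannedBy_homogeneousPart (2 * γ - s - 1)).mono
        (rightQuot_iterate_homogeneousPart ?_) (Nat.pow_le_pow_right (by omega) (by omega))
      rwa [show 2 * γ - s - 1 + (s + 1) = 2 * γ by omega]
  · have : 2 * γ * N ≤ s * N := Nat.mul_le_mul_right _ (by omega)
    have h2 : 2 * γ * N = r + s * N := by omega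
    refine (spannedBy_homogeneousPart 0).mono
      (rightQuot_iterate_homogeneousPart (by rwa [← h2, zero_add])) ?_
    rw [pow_zero]; exact Nat.mul_pos (pow_pos two_pos (γ + 1)) hM

theorem reversed_map_substitute (g : Fin 2 → FreeTwo K) (V : Submodule K (FreeTwo K)) :
    reversed (V.map (substitute g).toLinearMap) =
      (reversed V).map (substitute (reversal ∘ g)).toLinearMap := by
  simp only [reversed, ← Submodule.map_comp]
  congr 1
  refine ext_monomial fun w => ?_
  simp only [LinearMap.comp_apply, LinearEquiv.coe_coe, AlgHom.toLinearMap_apply,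
    reversal_monomialOf]
  induction w with
  | nil => simp
  | cons i w ih => simp [reversal_mul, ih, monomialOf_append]

theorem SpannedBy.leftQuot_map_substitute {N M γ : ℕ} (hG : G ≤ homogeneousPart K N) (hN : 0 < N)
    (hg : ∀ i, g i ∈ G) (hl : ∀ r, SpannedBy (leftQuot^[r] G) M) (hM : 1 ≤ M)
    (hP : P ≤ homogeneousPart K (2 * γ)) (hP2 : SpannedBy P 2) (a : ℕ) :
    SpannedBy (leftQuot^[a] (P.map (substitute g).toLinearMap)) (2 ^ (γ + 1) * M) := by
  have := SpannedBy.rightQuot_map_substitute (g := reversal ∘ g) (reversed_le_homogeneousPart hG)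
    hN (fun i => by simpa [mem_reversed] using hg i) (fun r => (hl r).rightQuot_reversed) hM
    (reversed_le_homogeneousPart hP) hP2.reverse a
  rw [← reversed_map_substitute] at this
  simpa using this.leftQuot_reversed

end Substitution

/-! ### Bounds for one stage of the construction -/

section Step

variable {K : Type*} [Field K] {G X P G' : Submodule K (FreeTwo K)} {g : Fin 2 → FreeTwo K}

/-- Since `n` is at most the degree of `G'`, a factor of `G' ^ t` meets at most two blocks. Within
one block it lies in the power of the line `X`, in the substituted pattern, or across their border;
only the pattern costs a factor `2 ^ (2 * γ)`, and `e` does not enter. -/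
theorem factors_step {N n M e γ : ℕ} (hG : G ≤ homogeneousPart K N) (hN : 0 < N)
    (hG2 : SpannedBy G 2) (hg : ∀ i, g i ∈ G)
    (hl : ∀ r, SpannedBy (leftQuot^[r] G) M) (hr : ∀ r, SpannedBy (rightQuot^[r] G) M)
    (hM : 1 ≤ M) (hP : P ≤ homogeneousPart K (2 * γ)) (hP2 : SpannedBy P 2)
    (hX : X ≤ G) (hX1 : SpannedBy X 1)
    (hG' : G' ≤ X ^ e * P.map (substitute g).toLinearMap) (hn : N < n)
    (hn' : n ≤ (e + 2 * γ) * N) :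
    ∃ B : Submodule K (FreeTwo K), SpannedBy B (8 * (n + 1) * 2 ^ (2 * γ) * M ^ 2) ∧
      ∀ t a b, a + b + n = t * ((e + 2 * γ) * N) →
        leftQuot^[a] (rightQuot^[b] (G' ^ t)) ≤ B := by
  set Y := P.map (substitute g).toLinearMap with hYdef
  have hXl : ∀ r, SpannedBy (leftQuot^[r] X) M := fun r =>
    (hl r).mono (leftQuot_iterate_mono r hX) le_rfl
  have hXr : ∀ r, SpannedBy (rightQuot^[r] X) M := fun r =>
    (hr r).mono (rightQuot_iterate_mono r hX) le_rfl
  have hXH := hX.trans hG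
  have hYG : Y ≤ G ^ (2 * γ) := map_substitute_le hg hP
  have hYH : Y ≤ homogeneousPart K (2 * γ * N) := hYG.trans (pow_le_homogeneousPart hG _)
  have hXeH : X ^ e ≤ homogeneousPart K (e * N) := pow_le_homogeneousPart hXH e
  have hYl := SpannedBy.leftQuot_map_substitute hG hN hg hl hM hP hP2
  have hYr := SpannedBy.rightQuot_map_substitute hG hN hg hr hM hP hP2
  have hXel := SpannedBy.leftQuot_pow hXH hN hX1 hXl hM e
  have hXer := SpannedBy.rightQuot_pow hXH hN hX1 hXr hM e
  have hXe1 : SpannedBy (X ^ e) 1 := by simpa using hX1.pow e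
  have hMD : M ≤ 2 ^ (γ + 1) * M := Nat.le_mul_of_pos_left _ (by positivity)
  have hf : FactorsSpannedBy G' ((e + 2 * γ) * N) n (4 * (n + 1) * 2 ^ (2 * γ) * M ^ 2) := by
    rw [add_mul]
    refine (FactorsSpannedBy.mul hXeH hYH (FactorsSpannedBy.pow hXH hn hN hXl hXr hX1 le_rfl e)
      ((FactorsSpannedBy.pow hG hn hN hl hr hG2 (by norm_num) (2 * γ)).mono hYG le_rfl)
      hXel hYr).mono hG' ?_
    have h1 : N ≤ n + 1 := by omega
    have h2 : 2 ^ (γ + 1) ≤ 2 * 2 ^ (2 * γ) := by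
      rw [← pow_succ']; exact Nat.pow_le_pow_right (by omega) (by omega)
    have h3 : 1 ≤ 2 ^ (2 * γ) := Nat.one_le_two_pow
    calc N * (M * 1 ^ e * M) + N * (M * 2 ^ (2 * γ) * M) + (n + 1) * (M * (2 ^ (γ + 1) * M))
        ≤ (n + 1) * (M * 2 ^ (2 * γ) * M) + (n + 1) * (M * 2 ^ (2 * γ) * M)
          + (n + 1) * (M * (2 * 2 ^ (2 * γ) * M)) := by rw [one_pow]; gcongr
      _ = _ := by ring
  have hG'l : ∀ a, SpannedBy (leftQuot^[a] G') (2 ^ (γ + 1) * M) := fun a => by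
    rcases le_or_gt a (e * N) with ha | ha
    · refine ((hXel a).mul (hP2.map _)).mono
        ((leftQuot_iterate_mono a hG').trans (leftQuot_iterate_mul_le hXeH ha Y)) ?_
      rw [mul_comm, pow_succ']
      exact Nat.mul_le_mul_right _ (Nat.le_mul_of_pos_right _ (by positivity))
    · refine (hYl (a - e * N)).mono ((leftQuot_iterate_mono a hG').trans ?_) le_rfl
      have := leftQuot_iterate_mul_le_right (a := a - e * N) hXeH Y
      rwa [Nat.sub_add_cancel ha.le] at this
  have hG'r : ∀ a, SpannedBy (rightQuot^[a] G') (2 ^ (γ + 1) * M) := fun a => by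
    rcases le_or_gt a (2 * γ * N) with ha | ha
    · exact (hXe1.mul (hYr a)).mono
        ((rightQuot_iterate_mono a hG').trans (rightQuot_iterate_mul_le _ hYH ha)) (by simp)
    · refine (hXer (a - 2 * γ * N)).mono ((rightQuot_iterate_mono a hG').trans ?_) hMD
      have := rightQuot_iterate_mul_le_left (a := a - 2 * γ * N) (X ^ e) hYH
      rwa [Nat.sub_add_cancel ha.le] at this
  have hG'H : G' ≤ homogeneousPart K ((e + 2 * γ) * N) := by
    rw [add_mul]; exact hG'.trans (mul_le_homogeneousPart hXeH hYH)
  obtain ⟨B, hB, h⟩ := FactorsSpannedBy.pow_of_le hG'H hn' (by omega) hf hG'l hG'r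
  -- Factors inside one block account for `4 * (n + 1) * 2 ^ (2 * γ) * M ^ 2`, those across two
  -- blocks for the same amount, because `(2 ^ (γ + 1) * M) ^ 2 = 4 * 2 ^ (2 * γ) * M ^ 2`.
  refine ⟨B, hB.mono le_rfl (le_of_eq ?_), h⟩
  ring

/-- A bound for one-sided quotients which does not depend on the exponent `e`. -/
theorem quotients_step {N e β : ℕ} (hX : X ≤ homogeneousPart K N) (hN : 0 < N)
    (hX1 : SpannedBy X 1) (hP : P ≤ homogeneousPart K (β * N)) (hG' : G' ≤ X ^ e * P) (a : ℕ) :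
    SpannedBy (leftQuot^[a] G') (2 ^ ((β + 1) * N)) ∧
      SpannedBy (rightQuot^[a] G') (2 ^ ((β + 1) * N)) := by
  -- The crude bound by full homogeneous parts suffices: a large `e` makes any bound in `N` and `β`
  -- negligible.
  have hl : ∀ a, SpannedBy (leftQuot^[a] X) (2 ^ N) := fun a => by
    rcases le_or_gt a N with ha | ha
    · exact (spannedBy_homogeneousPart (N - a)).mono
        (leftQuot_iterate_homogeneousPart (by rwa [Nat.sub_add_cancel ha]))
        (Nat.pow_le_pow_right (by omega) (by omega))
    · rw [leftQuot_iterate_eq_bot hX ha]; exact .bot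
  have hr : ∀ a, SpannedBy (rightQuot^[a] X) (2 ^ N) := fun a => by
    rcases le_or_gt a N with ha | ha
    · exact (spannedBy_homogeneousPart (N - a)).mono
        (rightQuot_iterate_homogeneousPart (by rwa [Nat.sub_add_cancel ha]))
        (Nat.pow_le_pow_right (by omega) (by omega))
    · rw [rightQuot_iterate_eq_bot hX ha]; exact .bot
  have hXel := SpannedBy.leftQuot_pow hX hN hX1 hl Nat.one_le_two_pow e
  have hXer := SpannedBy.rightQuot_pow hX hN hX1 hr Nat.one_le_two_pow e
  have hXe1 : SpannedBy (X ^ e) 1 := by simpa using hX1.pow e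
  have hXeH : X ^ e ≤ homogeneousPart K (e * N) := pow_le_homogeneousPart hX e
  have hP' : SpannedBy P (2 ^ (β * N)) := (spannedBy_homogeneousPart _).mono hP le_rfl
  have hpow : 2 ^ N * 2 ^ (β * N) = 2 ^ ((β + 1) * N) := by rw [← pow_add]; ring_nf
  constructor
  · rcases le_or_gt a (e * N) with ha | ha
    · exact ((hXel a).mul hP').mono
        ((leftQuot_iterate_mono a hG').trans (leftQuot_iterate_mul_le hXeH ha P)) hpow.le
    · have := leftQuot_iterate_mul_le_right (a := a - e * N) hXeH P
      rw [Nat.sub_add_cancel ha.le] at this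
      refine SpannedBy.mono ?_ ((leftQuot_iterate_mono a hG').trans this) le_rfl
      rcases le_or_gt (a - e * N) (β * N) with h | h
      · refine (spannedBy_homogeneousPart (β * N - (a - e * N))).mono
          (leftQuot_iterate_homogeneousPart (by rwa [Nat.sub_add_cancel h]))
          (Nat.pow_le_pow_right (by omega) ?_)
        rw [add_mul]; omega
      · rw [leftQuot_iterate_eq_bot hP h]; exact .bot
  · rcases le_or_gt a (β * N) with ha | ha
    · refine (hXe1.mul ((spannedBy_homogeneousPart (β * N - a)).mono
          (rightQuot_iterate_homogeneousPart (by rwa [Nat.sub_add_cancel ha])) le_rfl)).mono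
        ((rightQuot_iterate_mono a hG').trans (rightQuot_iterate_mul_le _ hP ha)) ?_
      rw [one_mul, add_mul]
      exact Nat.pow_le_pow_right (by omega) (by omega)
    · refine (hXer (a - β * N)).mono ((rightQuot_iterate_mono a hG').trans ?_)
        (Nat.pow_le_pow_right (by omega) (by rw [add_mul]; omega))
      have := rightQuot_iterate_mul_le_left (a := a - β * N) (X ^ e) hP
      rwa [Nat.sub_add_cancel ha.le] at this

end Step

/-! ### Choice of degrees and exponents -/

section Scales

theorem mul_add_two_le_four_pow {c t : ℕ} (h : c + 1 ≤ t) : c * t + 2 ≤ 4 ^ t := by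
  have h1 : t + 1 ≤ 2 ^ t := Nat.lt_two_pow_self
  have h2 : (4 : ℕ) ^ t = 2 ^ t * 2 ^ t := by rw [← mul_pow]; norm_num
  have h3 : (t + 1) * (t + 1) ≤ 2 ^ t * 2 ^ t := Nat.mul_le_mul h1 h1
  have h4 : c * t ≤ t * t := Nat.mul_le_mul_right _ (by omega)
  rw [h2]
  refine le_trans ?_ h3
  ring_nf
  nlinarith

/-- The degrees `n k` and the exponents used in the construction, for prescribed constants `C`. -/
theorem exists_scales (C : ℕ → ℕ) : ∃ n γ e : ℕ → ℕ, n 0 = 1 ∧ ∀ k,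
    n (k + 1) = (e k + 2 * γ k) * n k ∧ n k < n (k + 1) ∧ C k ≤ 2 * γ k ∧
    C k * (2 * γ k * n k) + 2 ≤ 2 ^ (2 * γ k) ∧ (2 ^ (2 * γ k)) ^ k ≤ n k ^ (k + 1) ∧
    (2 ^ ((2 * γ k + 1) * n k)) ^ (k + 1) ≤ n (k + 1) := by
  -- The lower bound for `t k` under which `mul_add_two_le_four_pow` gives the room for two
  -- independent patterns.
  let τ : ℕ → ℕ := fun k => C k * (2 * (k + 1)) + 2
  -- With `s = t k`, the product in the second entry is `(k + 1) * ((2 * γ k + 1) * n k)`: this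
  -- makes `n (k + 1)` dominate the quotient bound of stage `k`. The summand `s + 1` makes `t`
  -- increase.
  let t : ℕ → ℕ := fun k => Nat.rec (τ 0) (fun k s => max (τ (k + 1))
    ((k + 1) * ((2 * ((k + 1) * s) + 1) * 2 ^ (2 * k * s)) + s + 1)) k
  have ht : ∀ k, τ k ≤ t k := by
    rintro (_ | k)
    · exact le_rfl
    · exact le_max_left _ _
  have ht' : ∀ k, (k + 1) * ((2 * ((k + 1) * t k) + 1) * 2 ^ (2 * k * t k)) + t k + 1 ≤ t (k + 1) :=
    fun k => le_max_right _ _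
  clear_value t
  have hexp : ∀ k, 2 * k * t k + 2 * t (k + 1) ≤ 2 * (k + 1) * t (k + 1) := fun k => by
    have h1 : t k ≤ t (k + 1) := by have := ht' k; omega
    have h2 : 2 * k * t k ≤ 2 * k * t (k + 1) := Nat.mul_le_mul_left _ h1
    have h3 : 2 * (k + 1) * t (k + 1) = 2 * k * t (k + 1) + 2 * t (k + 1) := by ring
    omega
  have hγ : ∀ k, 2 * ((k + 1) * t k) ≤ t (k + 1) := fun k => by
    have h1 := ht' k
    have h2 : 2 * ((k + 1) * t k) + 1 ≤ (2 * ((k + 1) * t k) + 1) * 2 ^ (2 * k * t k) :=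
      Nat.le_mul_of_pos_right _ (by positivity)
    have h3 : (2 * ((k + 1) * t k) + 1) * 2 ^ (2 * k * t k) ≤
      (k + 1) * ((2 * ((k + 1) * t k) + 1) * 2 ^ (2 * k * t k)) :=
      Nat.le_mul_of_pos_left _ (by omega)
    omega
  -- These choices give `(2 ^ (2 * γ k)) ^ k = n k ^ (k + 1)` exactly, and `e k` is what the degree
  -- recursion requires; by `hexp` and `hγ` neither subtraction is truncated.
  refine ⟨fun k => 2 ^ (2 * k * t k), fun k => (k + 1) * t k,
    fun k => 2 ^ (2 * (k + 1) * t (k + 1) - 2 * k * t k) - 2 * ((k + 1) * t k), by simp,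
    fun k => ⟨?_, ?_, ?_, ?_, ?_, ?_⟩⟩
  · dsimp only
    rw [Nat.sub_add_cancel, ← pow_add, Nat.sub_add_cancel]
    · have := hexp k; omega
    · have h1 : 2 * (k + 1) * t (k + 1) - 2 * k * t k
        < 2 ^ (2 * (k + 1) * t (k + 1) - 2 * k * t k) := Nat.lt_two_pow_self
      have h2 := hexp k
      have h3 := hγ k
      omega
  · refine Nat.pow_lt_pow_right (by omega) ?_
    have h2 := hexp k
    have h3 := ht' k
    omega
  · dsimp only
    have h1 := ht k
    have h2 : C k * 1 ≤ C k * (2 * (k + 1)) := Nat.mul_le_mul_left _ (by omega)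
    have h3 : 1 * t k ≤ (k + 1) * t k := Nat.mul_le_mul_right _ (by omega)
    simp only [τ] at h1
    have h4 : 2 * ((k + 1) * t k) = (k + 1) * t k + (k + 1) * t k := by ring
    omega
  · have h1 : C k * (2 * (k + 1)) * t k + 2 ≤ 4 ^ t k :=
      mul_add_two_le_four_pow (by have := ht k; simp only [τ] at this; omega)
    have h2 : 1 ≤ 2 ^ (2 * k * t k) := Nat.one_le_two_pow
    calc C k * (2 * ((k + 1) * t k) * 2 ^ (2 * k * t k)) + 2
        ≤ (C k * (2 * (k + 1)) * t k + 2) * 2 ^ (2 * k * t k) := by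
          have h3 : (C k * (2 * (k + 1)) * t k + 2) * 2 ^ (2 * k * t k) =
            C k * (2 * ((k + 1) * t k) * 2 ^ (2 * k * t k)) + 2 * 2 ^ (2 * k * t k) := by ring
          omega
      _ ≤ 4 ^ t k * 2 ^ (2 * k * t k) := Nat.mul_le_mul_right _ h1
      _ = 2 ^ (2 * ((k + 1) * t k)) := by
          rw [show (4 : ℕ) = 2 ^ 2 by norm_num, ← pow_mul, ← pow_add]; ring_nf
  · dsimp only
    rw [← pow_mul, ← pow_mul]
    exact Nat.pow_le_pow_right (by omega) (le_of_eq (by ring))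
  · dsimp only
    rw [← pow_mul]
    refine Nat.pow_le_pow_right (by omega) ?_
    have h1 := ht' k
    have h2 := hexp k
    have h3 : (2 * ((k + 1) * t k) + 1) * 2 ^ (2 * k * t k) * (k + 1) =
      (k + 1) * ((2 * ((k + 1) * t k) + 1) * 2 ^ (2 * k * t k)) := by ring
    omega

end Scales

/-! ### Homogeneous components -/

section Components

variable {K : Type*} [Field K]

/-- The homogeneous component of degree `n`. -/
noncomputable def component (n : ℕ) : FreeTwo K →ₗ[K] FreeTwo K :=
  (monomialBasis K).constr K fun w => if w.length = n then monomialOf K w else 0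

theorem component_monomialOf (n : ℕ) (w : List (Fin 2)) :
    component n (monomialOf K w) = if w.length = n then monomialOf K w else 0 := by
  rw [component, ← monomialBasis_apply, Basis.constr_basis, monomialBasis_apply]

theorem component_of_mem {n : ℕ} {a : FreeTwo K} (ha : a ∈ homogeneousPart K n) (m : ℕ) :
    component m a = if n = m then a else 0 := by
  have : homogeneousPart K n ≤ LinearMap.eqLocus (component m)
      (if n = m then LinearMap.id else 0 : FreeTwo K →ₗ[K] FreeTwo K) := by
    refine homogeneousPart_le fun w hw => ?_
    rw [LinearMap.mem_eqLocus, component_monomialOf, hw]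
    split_ifs <;> simp
  have h := LinearMap.mem_eqLocus.1 (this ha)
  rw [h]; split_ifs <;> simp

theorem component_self {n : ℕ} {a : FreeTwo K} (ha : a ∈ homogeneousPart K n) :
    component n a = a := by simp [component_of_mem ha]

theorem component_mem (n : ℕ) (a : FreeTwo K) : component n a ∈ homogeneousPart K n := by
  have : (⊤ : Submodule K (FreeTwo K)) ≤ (homogeneousPart K n).comap (component n) := by
    rw [← span_monomial, Submodule.span_le]
    rintro _ ⟨w, rfl⟩
    simp only [Submodule.comap_coe, Set.mem_preimage, component_monomialOf, SetLike.mem_coe]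
    split_ifs with h
    · exact monomialOf_mem h
    · exact zero_mem _
  exact this Submodule.mem_top

theorem exists_sum_component (a : FreeTwo K) : ∃ d, ∀ e, d ≤ e →
    ∑ i ∈ Finset.range (e + 1), component i a = a := by
  have : a ∈ Submodule.span K (Set.range (monomialOf K)) := by rw [span_monomial]; trivial
  induction this using Submodule.span_induction with
  | mem a h =>
    obtain ⟨w, rfl⟩ := h
    refine ⟨w.length, fun e he => ?_⟩
    simp only [component_monomialOf, Finset.sum_ite_eq, Finset.mem_range]
    rw [if_pos (by omega)]
  | zero => exact ⟨0, by simp⟩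
  | add a b _ _ ha hb =>
    obtain ⟨d, hd⟩ := ha
    obtain ⟨e, he⟩ := hb
    refine ⟨max d e, fun m hm => ?_⟩
    simp only [map_add, Finset.sum_add_distrib]
    rw [hd m (le_of_max_le_left hm), he m (le_of_max_le_right hm)]
  | smul c a _ ha =>
    obtain ⟨d, hd⟩ := ha
    refine ⟨d, fun m hm => ?_⟩
    simp only [map_smul, ← Finset.smul_sum, hd m hm]

theorem component_mul {n : ℕ} {a : FreeTwo K} (ha : a ∈ homogeneousPart K n) (b : FreeTwo K)
    (m : ℕ) : component m (a * b) = if n ≤ m then a * component (m - n) b else 0 := by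
  obtain ⟨d, hd⟩ := exists_sum_component b
  have hb := hd (max d m) (le_max_left _ _)
  conv_lhs => rw [← hb, Finset.mul_sum, map_sum]
  have h : ∀ i, component m (a * component i b) = if n + i = m then a * component i b else 0 :=
    fun i => component_of_mem (by
      rw [← homogeneousPart_mul]
      exact Submodule.mul_mem_mul ha (component_mem i b)) m
  simp only [h]
  split_ifs with hnm
  · rw [Finset.sum_eq_single (m - n)]
    · rw [if_pos (by omega)]
    · intro i _ hi; rw [if_neg (by omega)]
    · intro hi; exact absurd (Finset.mem_range.2 (by have := le_max_right d m; omega)) hi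
  · exact Finset.sum_eq_zero fun i _ => by rw [if_neg (by omega)]

theorem component_mul_right {n : ℕ} {b : FreeTwo K} (hb : b ∈ homogeneousPart K n)
    (a : FreeTwo K) (m : ℕ) :
    component m (a * b) = if n ≤ m then component (m - n) a * b else 0 := by
  obtain ⟨d, hd⟩ := exists_sum_component a
  have ha := hd (max d m) (le_max_left _ _)
  conv_lhs => rw [← ha, Finset.sum_mul, map_sum]
  have h : ∀ i, component m (component i a * b) = if i + n = m then component i a * b else 0 :=
    fun i => component_of_mem (by
      rw [← homogeneousPart_mul]
      exact Submodule.mul_mem_mul (component_mem i a) hb) m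
  simp only [h]
  split_ifs with hnm
  · rw [Finset.sum_eq_single (m - n)]
    · rw [if_pos (by omega)]
    · intro i _ hi; rw [if_neg (by omega)]
    · intro hi; exact absurd (Finset.mem_range.2 (by have := le_max_right d m; omega)) hi
  · exact Finset.sum_eq_zero fun i _ => by rw [if_neg (by omega)]

theorem component_zero_eq (a : FreeTwo K) :
    component 0 a = algebraMap K _ (FreeAlgebra.algebraMapInv a) := by
  have : (component 0 : FreeTwo K →ₗ[K] FreeTwo K) =
      Algebra.linearMap K _ ∘ₗ (FreeAlgebra.algebraMapInv (R := K) (X := Fin 2)).toLinearMap := by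
    refine ext_monomial fun w => ?_
    rcases w with _ | ⟨i, w⟩
    · rw [component_monomialOf]; simp
    · rw [component_monomialOf]
      simp [FreeAlgebra.algebraMapInv]
  exact LinearMap.congr_fun this a

theorem component_zero_eq_zero {a : FreeTwo K} (ha : a ∈ augIdeal K) : component 0 a = 0 := by
  rw [component_zero_eq, show FreeAlgebra.algebraMapInv a = 0 from ha, map_zero]

theorem component_one (n : ℕ) : component n (1 : FreeTwo K) = if n = 0 then 1 else 0 := by
  have := component_monomialOf (K := K) n []
  simpa [eq_comm] using this

end Components

/-! ### Segments of the powers of one polynomial -/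

section Powers

variable {K : Type*} [Field K] {f : FreeTwo K} {d : ℕ}

theorem component_mul_eq_sum (hf : ∑ i ∈ Finset.range (d + 1), component i f = f) (b : FreeTwo K)
    (D : ℕ) : component D (f * b) = ∑ i ∈ Finset.range (d + 1),
      if i ≤ D then component i f * component (D - i) b else 0 := by
  conv_lhs => rw [← hf, Finset.sum_mul, map_sum]
  exact Finset.sum_congr rfl fun i _ => component_mul (component_mem i f) b D

theorem component_mul_eq_sum_right (hf : ∑ i ∈ Finset.range (d + 1), component i f = f)
    (b : FreeTwo K) (D : ℕ) : component D (b * f) = ∑ i ∈ Finset.range (d + 1),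
      if i ≤ D then component (D - i) b * component i f else 0 := by
  conv_lhs => rw [← hf, Finset.mul_sum, map_sum]
  exact Finset.sum_congr rfl fun i _ => component_mul_right (component_mem i f) b D

theorem component_pow_eq_zero (hf0 : component 0 f = 0) {m n : ℕ} (h : n < m) :
    component n (f ^ m) = 0 := by
  obtain ⟨d, hd⟩ := exists_sum_component f
  induction m generalizing n with
  | zero => omega
  | succ m ih =>
    rw [pow_succ', component_mul_eq_sum (hd d le_rfl)]
    refine Finset.sum_eq_zero fun i _ => ?_
    rcases Nat.eq_zero_or_pos i with rfl | hi
    · simp [hf0]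
    · split_ifs with hin
      · rw [ih (by omega), mul_zero]
      · rfl

/-- The components of degree `n` of the powers of `f`. -/
noncomputable def powerComponents (f : FreeTwo K) (n : ℕ) : Submodule K (FreeTwo K) :=
  Submodule.span K (Set.range fun m => component n (f ^ m))

theorem powerComponents_le (f : FreeTwo K) (n : ℕ) : powerComponents f n ≤ homogeneousPart K n := by
  rw [powerComponents, Submodule.span_le]
  rintro _ ⟨m, rfl⟩
  exact component_mem _ _

theorem mem_powerComponents (f : FreeTwo K) (n m : ℕ) :
    component n (f ^ m) ∈ powerComponents f n := Submodule.subset_span ⟨m, rfl⟩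

/-- Without constant term only the exponents `m ≤ n` contribute. This linear growth, against the
exponential growth of the homogeneous parts, is the source of nilpotency. -/
theorem spannedBy_powerComponents (hf0 : component 0 f = 0) (n : ℕ) :
    SpannedBy (powerComponents f n) (n + 1) := by
  classical
  refine ⟨(Finset.range (n + 1)).image fun m => component n (f ^ m),
    Finset.card_image_le.trans (by simp), ?_⟩
  rw [powerComponents, Submodule.span_le]
  rintro _ ⟨m, rfl⟩
  rcases lt_or_ge n m with h | h
  · simp [component_pow_eq_zero hf0 h]
  · refine Submodule.subset_span ?_
    simp only [Finset.coe_image, Set.mem_image, Finset.coe_range, Set.mem_Iio]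
    exact ⟨m, by omega, rfl⟩

/-- Cut a product of terms of `f` after `p` letters. The term at the cut leaves at most `d` letters
on the right, and what follows is a component of a power of `f`. -/
theorem component_pow_mem_left (hf : ∑ i ∈ Finset.range (d + 1), component i f = f) (N p q : ℕ) :
    component (p + q) (f ^ N) ∈ homogeneousPart K p *
      ⨆ i : Fin (min d q + 1), homogeneousPart K i * powerComponents f (q - i) := by
  have key : ∀ i, i ≤ d → i ≤ q → homogeneousPart K i * powerComponents f (q - i) ≤
      ⨆ i : Fin (min d q + 1), homogeneousPart K i * powerComponents f (q - i) := fun i h1 h2 =>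
    le_iSup (fun i : Fin (min d q + 1) => homogeneousPart K i * powerComponents f (q - i))
      ⟨i, by omega⟩
  induction N generalizing p with
  | zero =>
    rw [pow_zero, component_one]
    split_ifs with h
    · obtain ⟨rfl, rfl⟩ : p = 0 ∧ q = 0 := by omega
      rw [← one_mul (1 : FreeTwo K)]
      refine Submodule.mul_mem_mul (by simp [homogeneousPart_zero])
        (key 0 (by omega) le_rfl ?_)
      rw [← one_mul (1 : FreeTwo K)]
      refine Submodule.mul_mem_mul (by simp [homogeneousPart_zero]) ?_
      have := mem_powerComponents f 0 0
      simpa [component_one] using this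
    · exact zero_mem _
  | succ N ih =>
    rw [pow_succ', component_mul_eq_sum hf]
    refine Submodule.sum_mem _ fun i hi => ?_
    rw [Finset.mem_range] at hi
    split_ifs with h
    · rcases le_or_gt i p with hip | hip
      · rw [show p + q - i = (p - i) + q by omega]
        have h1 := Submodule.mul_mem_mul (component_mem i f) (ih (p - i))
        rwa [← mul_assoc, homogeneousPart_mul, Nat.add_sub_cancel' hip] at h1
      · have h1 : component i f ∈ homogeneousPart K p * homogeneousPart K (i - p) := by
          rw [homogeneousPart_mul, Nat.add_sub_cancel' hip.le]; exact component_mem i f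
        rw [show p + q - i = q - (i - p) by omega]
        have h2 := Submodule.mul_mem_mul h1 (mem_powerComponents f (q - (i - p)) N)
        rw [mul_assoc] at h2
        exact mul_le_mul' le_rfl (key (i - p) (by omega) (by omega)) h2
    · exact zero_mem _

theorem component_pow_mem_right (hf : ∑ i ∈ Finset.range (d + 1), component i f = f) (N p q : ℕ) :
    component (q + p) (f ^ N) ∈
      (⨆ i : Fin (min d q + 1), powerComponents f (q - i) * homogeneousPart K i) *
        homogeneousPart K p := by
  have key : ∀ i, i ≤ d → i ≤ q → powerComponents f (q - i) * homogeneousPart K i ≤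
      ⨆ i : Fin (min d q + 1), powerComponents f (q - i) * homogeneousPart K i := fun i h1 h2 =>
    le_iSup (fun i : Fin (min d q + 1) => powerComponents f (q - i) * homogeneousPart K i)
      ⟨i, by omega⟩
  induction N generalizing p with
  | zero =>
    rw [pow_zero, component_one]
    split_ifs with h
    · obtain ⟨rfl, rfl⟩ : p = 0 ∧ q = 0 := by omega
      rw [← one_mul (1 : FreeTwo K)]
      refine Submodule.mul_mem_mul (key 0 (by omega) le_rfl ?_) (by simp [homogeneousPart_zero])
      rw [← one_mul (1 : FreeTwo K)]
      refine Submodule.mul_mem_mul ?_ (by simp [homogeneousPart_zero])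
      have := mem_powerComponents f 0 0
      simpa [component_one] using this
    · exact zero_mem _
  | succ N ih =>
    rw [pow_succ, component_mul_eq_sum_right hf]
    refine Submodule.sum_mem _ fun i hi => ?_
    rw [Finset.mem_range] at hi
    split_ifs with h
    · rcases le_or_gt i p with hip | hip
      · rw [show q + p - i = q + (p - i) by omega]
        have h1 := Submodule.mul_mem_mul (ih (p - i)) (component_mem i f)
        rwa [mul_assoc, homogeneousPart_mul, Nat.sub_add_cancel hip] at h1
      · have h1 : component i f ∈ homogeneousPart K (i - p) * homogeneousPart K p := by
          rw [homogeneousPart_mul, Nat.sub_add_cancel hip.le]; exact component_mem i f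
        rw [show q + p - i = q - (i - p) by omega]
        have h2 := Submodule.mul_mem_mul (mem_powerComponents f (q - (i - p)) N) h1
        rw [← mul_assoc] at h2
        exact mul_le_mul' (key (i - p) (by omega) (by omega)) le_rfl h2
    · exact zero_mem _

/-- The powers of `f` are, at every position, built from a space of segments of length `w` whose
dimension grows only linearly with `w`. -/
theorem exists_segments (hf0 : component 0 f = 0) : ∃ C : ℕ, ∀ w, C ≤ w →
    ∃ F : Submodule K (FreeTwo K), F ≤ homogeneousPart K w ∧ SpannedBy F (C * w) ∧
      ∀ N p q, component (p + w + q) (f ^ N) ∈ homogeneousPart K p * F * homogeneousPart K q := by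
  obtain ⟨d, hd⟩ := exists_sum_component f
  have hf := hd d le_rfl
  -- At each end there are at most `d + 1` lengths of a truncated term, costing at most `2 ^ d`; the
  -- power between them costs at most `w + 1 ≤ 2 * w`. The constant also forces `d < w`.
  refine ⟨(d + 1) * ((d + 1) * (2 ^ d * (2 * 2 ^ d))), fun w hw => ?_⟩
  have hpos : 0 < 2 ^ d * (2 * 2 ^ d) := by positivity
  have hdw : d + 1 ≤ w := by
    refine le_trans ?_ hw
    exact Nat.le_mul_of_pos_right _ (Nat.mul_pos (by omega) hpos)
  refine ⟨⨆ i : Fin (d + 1), ⨆ j : Fin (min d (w - i) + 1), homogeneousPart K i *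
    (powerComponents f (w - i - j) * homogeneousPart K j), ?_, ?_, ?_⟩
  · refine iSup_le fun i => iSup_le fun j => ?_
    refine (mul_le_homogeneousPart le_rfl (mul_le_homogeneousPart
      (powerComponents_le f _) le_rfl)).trans (le_of_eq (congrArg _ ?_))
    have := i.2; have := j.2; omega
  · have h1 : ∀ i : Fin (d + 1), SpannedBy (⨆ j : Fin (min d (w - i) + 1), homogeneousPart K i *
        (powerComponents f (w - i - j) * homogeneousPart K j))
        ((d + 1) * (2 ^ d * (2 * w * 2 ^ d))) := fun i => by
      refine (SpannedBy.iSup (d := 2 ^ d * (2 * w * 2 ^ d)) _ fun j => ?_).mono le_rfl ?_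
      · refine ((spannedBy_homogeneousPart _).mul ((spannedBy_powerComponents hf0 _).mul
          (spannedBy_homogeneousPart _))).mono le_rfl ?_
        have := i.2; have := j.2
        gcongr <;> omega
      · rw [Fintype.card_fin]
        exact Nat.mul_le_mul_right _ (by omega)
    refine (SpannedBy.iSup _ h1).mono le_rfl (le_of_eq ?_)
    rw [Fintype.card_fin]; ring
  · intro N p q
    rw [add_assoc]
    -- Cut at the left end first, then cut the remaining power at the right end.
    have h1 := component_pow_mem_left hf N p (w + q)
    refine SetLike.le_def.1 ?_ h1
    rw [mul_assoc]
    refine mul_le_mul' le_rfl (iSup_le fun i => ?_)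
    have hi := i.2
    have h2 : powerComponents f (w + q - i) ≤
        (⨆ j : Fin (min d (w - i) + 1), powerComponents f (w - i - j) * homogeneousPart K j) *
        homogeneousPart K q := by
      rw [powerComponents, Submodule.span_le]
      rintro _ ⟨m, rfl⟩
      rw [show w + q - i = w - i + q by omega]
      exact component_pow_mem_right hf m q (w - i)
    refine (mul_le_mul' le_rfl h2).trans ?_
    rw [← mul_assoc]
    refine mul_le_mul' ?_ le_rfl
    refine le_trans ?_ (le_iSup (fun i : Fin (d + 1) => ⨆ j : Fin (min d (w - i) + 1),
      homogeneousPart K i * (powerComponents f (w - i - j) * homogeneousPart K j)) ⟨i, by omega⟩)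
    rw [Submodule.mul_iSup]

end Powers

/-! ### Injectivity of substitution and choice of the pairs -/

section Construction

variable {K : Type*} [Field K]

theorem eq_zero_of_pairing {a : FreeTwo K} (h : ∀ w, pairing (monomialOf K w) a = 0) : a = 0 := by
  refine (monomialBasis K).ext_elem fun w => ?_
  have := h w
  rw [pairing, ← monomialBasis_apply, Basis.constr_basis, Basis.coord_apply] at this
  simp [this]

theorem eq_zero_of_pairing_of_mem {n : ℕ} {a : FreeTwo K} (ha : a ∈ homogeneousPart K n)
    (h : ∀ u : List (Fin 2), u.length = n → pairing (monomialOf K u) a = 0) : a = 0 := by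
  refine eq_zero_of_pairing fun w => ?_
  by_cases hw : w.length = n
  · exact h w hw
  · exact pairing_eq_zero hw (monomialOf_mem rfl) ha

/-- Pairing the right-hand factors with a fixed word `v` turns the relation into a scalar relation
among the `g i`, because the form splits after degree `N`. -/
theorem eq_zero_of_sum_mul_eq_zero {N : ℕ} {g : Fin 2 → FreeTwo K}
    (hg : ∀ i, g i ∈ homogeneousPart K N) (hli : LinearIndependent K g) {b : Fin 2 → FreeTwo K}
    (h : ∑ i, g i * b i = 0) (i : Fin 2) : b i = 0 := by
  refine eq_zero_of_pairing fun v => ?_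
  have h1 : ∑ i, pairing (monomialOf K v) (b i) • g i = 0 := by
    refine eq_zero_of_pairing_of_mem (n := N)
      (Submodule.sum_mem _ fun i _ => Submodule.smul_mem _ _ (hg i)) fun u hu => ?_
    have h2 := congrArg (pairing (monomialOf K u * monomialOf K v)) h
    rw [map_sum, map_zero] at h2
    rw [map_sum, ← h2]
    refine Finset.sum_congr rfl fun i _ => ?_
    rw [pairing_mul_mul (monomialOf_mem hu) (hg i), map_smul, smul_eq_mul, mul_comm]
  exact Fintype.linearIndependent_iff.1 hli _ h1 i

/-- `eq_zero_of_sum_mul_eq_zero` peels off one letter of the pattern at a time. -/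
theorem eq_zero_of_substitute_eq_zero {N n : ℕ} {g : Fin 2 → FreeTwo K}
    (hg : ∀ i, g i ∈ homogeneousPart K N) (hli : LinearIndependent K g) {a : FreeTwo K}
    (ha : a ∈ homogeneousPart K n) (h : substitute g a = 0) : a = 0 := by
  induction n generalizing a with
  | zero =>
    rw [homogeneousPart_zero, Submodule.mem_one] at ha
    obtain ⟨r, rfl⟩ := ha
    rwa [AlgHom.commutes] at h
  | succ n ih =>
    rw [← sum_ι_mul_leftDiv ha, map_sum] at h
    simp only [map_mul, substitute_ι] at h
    have h1 := eq_zero_of_sum_mul_eq_zero hg hli h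
    rw [← sum_ι_mul_leftDiv ha]
    refine Finset.sum_eq_zero fun i _ => ?_
    rw [ih (leftDiv_mem ha i) (h1 i), mul_zero]

instance (n : ℕ) : Module.Finite K (homogeneousPart K n) := (spannedBy_homogeneousPart n).finite

theorem two_pow_le_finrank_homogeneousPart (n : ℕ) :
    2 ^ n ≤ finrank K (homogeneousPart K n) := by
  have h1 : LinearIndependent K fun v : Fin n → Fin 2 =>
      (⟨monomialOf K (List.ofFn v), monomialOf_mem (by simp)⟩ : homogeneousPart K n) := by
    refine LinearIndependent.of_comp (homogeneousPart K n).subtype ?_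
    have h2 := (monomialBasis K).linearIndependent.comp (fun v : Fin n → Fin 2 => List.ofFn v)
      List.ofFn_injective
    have h3 : (homogeneousPart K n).subtype ∘ (fun v : Fin n → Fin 2 =>
        (⟨monomialOf K (List.ofFn v), monomialOf_mem (by simp)⟩ : homogeneousPart K n)) =
        monomialBasis K ∘ fun v : Fin n → Fin 2 => List.ofFn v := by
      funext v; simp
    rwa [h3]
  simpa using h1.fintype_card_le_finrank

theorem exists_pair_mem_ker {E ι : Type*} [AddCommGroup E] [Module K E] [Module.Finite K E]
    [Fintype ι] (T : E →ₗ[K] (ι → K)) (h : Fintype.card ι + 2 ≤ finrank K E) :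
    ∃ ψ : Fin 2 → E, LinearIndependent K ψ ∧ ∀ i, T (ψ i) = 0 := by
  have h1 := LinearMap.finrank_range_add_finrank_ker T
  have h2 : finrank K (LinearMap.range T) ≤ Fintype.card ι :=
    (Submodule.finrank_le _).trans (by simp)
  have h4 : 2 ≤ finrank K (LinearMap.ker T) := by omega
  let b := Module.finBasis K (LinearMap.ker T)
  exact ⟨fun i => b (Fin.castLE h4 i), (b.linearIndependent.comp (Fin.castLE h4)
    (Fin.castLE_injective h4)).map' (LinearMap.ker T).subtype (Submodule.ker_subtype _),
    fun i => LinearMap.mem_ker.1 (b (Fin.castLE h4 i)).2⟩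

/-- Orthogonality to `F` imposes at most `d` linear conditions on a pattern from a space of
dimension at least `2 ^ n`, so two independent solutions remain. -/
theorem exists_annihilating_pair {F : Submodule K (FreeTwo K)} {d n : ℕ} (hF : SpannedBy F d)
    (h : d + 2 ≤ 2 ^ n) (g : Fin 2 → FreeTwo K) :
    ∃ ψ : Fin 2 → FreeTwo K, (∀ i, ψ i ∈ homogeneousPart K n) ∧ LinearIndependent K ψ ∧
      ∀ i, ∀ a ∈ F, pairing (substitute g (ψ i)) a = 0 := by
  obtain ⟨S, hS, hFS⟩ := hF
  obtain ⟨ψ, hψ, hT⟩ := exists_pair_mem_ker (K := K) (E := homogeneousPart K n) (ι := S)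
    (LinearMap.pi fun s => pairing.flip (s : FreeTwo K) ∘ₗ (substitute g).toLinearMap ∘ₗ
      (homogeneousPart K n).subtype)
    (le_trans (by simpa using hS) (h.trans (two_pow_le_finrank_homogeneousPart n)))
  refine ⟨fun i => ψ i, fun i => (ψ i).2,
    hψ.map' (homogeneousPart K n).subtype (Submodule.ker_subtype _), fun i a ha => ?_⟩
  have h5 : Submodule.span K (S : Set (FreeTwo K)) ≤
      LinearMap.ker (pairing (substitute g (ψ i))) := by
    rw [Submodule.span_le]
    intro s hs
    exact congrFun (hT i) ⟨s, hs⟩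
  exact h5 (hFS ha)

theorem exists_nat_rec {α : Type*} {P : ℕ → α → Prop} {R : ℕ → α → α → Prop} {a : α} (h₀ : P 0 a)
    (h : ∀ k x, P k x → ∃ y, P (k + 1) y ∧ R k x y) :
    ∃ s : ℕ → α, s 0 = a ∧ ∀ k, P k (s k) ∧ R k (s k) (s (k + 1)) := by
  choose! f hf using h
  let s : ℕ → α := fun k => Nat.rec a f k
  have hs : ∀ k, P k (s k) := fun k => by
    induction k with
    | zero => exact h₀
    | succ k ih => exact (hf k _ ih).1
  exact ⟨s, rfl, fun k => ⟨hs k, (hf k _ (hs k)).2⟩⟩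

/-- Dependent choice with degree and independence as invariant. The common prefix `g k 0 ^ e k` only
inflates the degree. -/
theorem exists_generators {n γ e : ℕ → ℕ} (hn0 : n 0 = 1)
    (hn : ∀ k, n (k + 1) = (e k + 2 * γ k) * n k) {F : ℕ → Submodule K (FreeTwo K)} {d : ℕ → ℕ}
    (hF : ∀ k, SpannedBy (F k) (d k)) (hd : ∀ k, d k + 2 ≤ 2 ^ (2 * γ k)) :
    ∃ g : ℕ → Fin 2 → FreeTwo K, ∀ k, (∀ i, g k i ∈ homogeneousPart K (n k)) ∧
      LinearIndependent K (g k) ∧ ∃ ψ : Fin 2 → FreeTwo K,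
        (∀ i, ψ i ∈ homogeneousPart K (2 * γ k)) ∧
        (∀ i, g (k + 1) i = g k 0 ^ e k * substitute (g k) (ψ i)) ∧
        ∀ i, ∀ a ∈ F k, pairing (substitute (g k) (ψ i)) a = 0 := by
  have := exists_nat_rec (α := Fin 2 → FreeTwo K) (a := FreeAlgebra.ι K)
    (P := fun k g => (∀ i, g i ∈ homogeneousPart K (n k)) ∧ LinearIndependent K g)
    (R := fun k g g' => ∃ ψ : Fin 2 → FreeTwo K, (∀ i, ψ i ∈ homogeneousPart K (2 * γ k)) ∧
        (∀ i, g' i = g 0 ^ e k * substitute g (ψ i)) ∧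
        ∀ i, ∀ a ∈ F k, pairing (substitute g (ψ i)) a = 0) ?_ ?_
  · obtain ⟨g, -, hg⟩ := this
    exact ⟨g, fun k => ⟨(hg k).1.1, (hg k).1.2, (hg k).2⟩⟩
  · refine ⟨fun i => by rw [hn0]; exact ι_mem i, ?_⟩
    have h2 := (monomialBasis K).linearIndependent.comp (fun i : Fin 2 => [i])
      (fun i j h => by simpa using h)
    convert h2 using 1
    ext i
    simp
  · rintro k g ⟨hg, hli⟩
    obtain ⟨ψ, hψ, hψli, hψF⟩ := exists_annihilating_pair (hF k) (hd k) g
    refine ⟨fun i => g 0 ^ e k * substitute g (ψ i), ⟨fun i => ?_, ?_⟩, ψ, hψ, fun i => rfl, hψF⟩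
    · rw [hn, add_mul, ← homogeneousPart_mul]
      refine Submodule.mul_mem_mul ?_ ?_
      · rw [← homogeneousPart_pow]; exact Submodule.pow_mem_pow _ (hg 0) _
      · rw [← homogeneousPart_pow]
        exact map_substitute_le hg le_rfl (Submodule.mem_map_of_mem (hψ i))
    · rw [Fintype.linearIndependent_iff] at hψli ⊢
      intro c hc
      refine hψli c ?_
      refine eq_zero_of_substitute_eq_zero hg hli
        (Submodule.sum_mem _ fun i _ => Submodule.smul_mem _ _ (hψ i)) ?_
      have h1 : g 0 ^ e k * substitute g (∑ i, c i • ψ i) = 0 := by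
        rw [← hc, map_sum, Finset.mul_sum]
        simp
      -- The free algebra has no zero divisors, so the prefix cancels.
      exact (mul_eq_zero.1 h1).resolve_left (pow_ne_zero _ (hli.ne_zero 0))

end Construction

/-! ### Orthogonal spaces -/

section Orthogonality

variable {K : Type*} [Field K] {C C' V V' : Submodule K (FreeTwo K)}

/-- Orthogonality with respect to the pairing. -/
def Orthogonal (C V : Submodule K (FreeTwo K)) : Prop :=
  ∀ c ∈ C, ∀ v ∈ V, pairing c v = 0

theorem Orthogonal.mono (h : Orthogonal C V) (hC : C' ≤ C) (hV : V' ≤ V) : Orthogonal C' V' :=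
  fun c hc v hv => h c (hC hc) v (hV hv)

theorem orthogonal_leftQuot (h : Orthogonal (homogeneousPart K 1 * C) V) :
    Orthogonal C (leftQuot V) := by
  intro c hc v hv
  have : leftQuot V ≤ LinearMap.ker (pairing c) := leftQuot_le fun i a ha => by
    rw [LinearMap.mem_ker, ← pairing_ι_mul]
    exact h _ (Submodule.mul_mem_mul (ι_mem i) hc) a ha
  exact this hv

/-- By adjointness, testing against a factor amounts to testing against the whole with arbitrary
letters in place of the erased ones. -/
theorem orthogonal_leftQuot_iterate {a : ℕ} (h : Orthogonal (homogeneousPart K a * C) V) :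
    Orthogonal C (leftQuot^[a] V) := by
  induction a generalizing V with
  | zero => simpa [homogeneousPart_zero] using h
  | succ a ih =>
    rw [Function.iterate_succ_apply]
    refine ih (orthogonal_leftQuot ?_)
    rwa [← mul_assoc, homogeneousPart_mul, add_comm 1 a]

theorem orthogonal_reversed (h : Orthogonal C V) : Orthogonal (reversed C) (reversed V) := by
  intro c hc v hv
  have := h _ (mem_reversed.1 hc) _ (mem_reversed.1 hv)
  rwa [pairing_reversal, reversal_reversal] at this

theorem orthogonal_rightQuot_iterate {a : ℕ} (h : Orthogonal (C * homogeneousPart K a) V) :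
    Orthogonal C (rightQuot^[a] V) := by
  have := orthogonal_reversed h
  rw [reversed_mul, reversed_homogeneousPart] at this
  rw [rightQuot_iterate_eq]
  simpa using orthogonal_reversed (orthogonal_leftQuot_iterate this)

theorem orthogonal_mul_of {n : ℕ} (hC : C ≤ homogeneousPart K n) (hV : V ≤ homogeneousPart K n)
    (h : Orthogonal C V ∨ Orthogonal C' V') : Orthogonal (C * C') (V * V') := by
  intro c hc v hv
  have h1 : C * C' ≤ LinearMap.ker (pairing.flip v) := Submodule.mul_le.2 fun a ha b hb => by
    have h2 : V * V' ≤ LinearMap.ker (pairing (a * b)) := Submodule.mul_le.2 fun x hx y hy => by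
      rw [LinearMap.mem_ker, pairing_mul_mul (hC ha) (hV hx)]
      rcases h with h | h
      · rw [h a ha x hx, zero_mul]
      · rw [h b hb y hy, mul_zero]
    exact h2 hv
  exact h1 hc

theorem pairing_component (n : ℕ) (a b : FreeTwo K) :
    pairing (component n a) b = pairing a (component n b) := by
  have : (pairing ∘ₗ component n :
      FreeTwo K →ₗ[K] FreeTwo K →ₗ[K] K) = (pairing.compl₂ (component n)) :=
    ext_monomial fun u => ext_monomial fun w => by
      simp only [LinearMap.comp_apply, LinearMap.compl₂_apply, component_monomialOf]
      by_cases h : u = w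
      · subst h; split_ifs <;> simp
      · split_ifs <;> simp [pairing_monomialOf, h]
  exact LinearMap.congr_fun (LinearMap.congr_fun this a) b

end Orthogonality

/-! ### The ideal orthogonal to a space closed under quotients -/

section Ideal

variable {K : Type*} [Field K]

theorem mem_augIdeal_of_mem {n : ℕ} (hn : n ≠ 0) {a : FreeTwo K} (ha : a ∈ homogeneousPart K n) :
    a ∈ augIdeal K := by
  change FreeAlgebra.algebraMapInv a = 0
  have h := component_zero_eq a
  rw [component_of_mem ha, if_neg hn] at h
  exact (FaithfulSMul.algebraMap_injective K (FreeTwo K)) (by rw [← h, map_zero])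

theorem component_mem_augIdeal {a : FreeTwo K} (ha : a ∈ augIdeal K) (n : ℕ) :
    component n a ∈ augIdeal K := by
  rcases eq_or_ne n 0 with rfl | hn
  · rw [component_zero_eq_zero ha]; exact zero_mem _
  · exact mem_augIdeal_of_mem hn (component_mem n a)

theorem pairing_mul_eq_zero_left {L : Submodule K (FreeTwo K)} (hl : leftQuot L ≤ L)
    {a : FreeTwo K} (ha : ∀ l ∈ L, pairing a l = 0) (r : FreeTwo K) :
    ∀ l ∈ L, pairing (r * a) l = 0 := by
  intro l hL
  have h1 : ∀ w : List (Fin 2), ∀ l ∈ L, pairing (monomialOf K w * a) l = 0 := by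
    intro w
    induction w with
    | nil => simpa using ha
    | cons i w ih =>
      intro l hL
      rw [monomialOf_cons, mul_assoc, pairing_ι_mul]
      exact ih _ (hl (leftDiv_mem_leftQuot hL i))
  have h2 : (pairing.flip l ∘ₗ LinearMap.mulRight K a : FreeTwo K →ₗ[K] K) = 0 :=
    ext_monomial fun w => by simpa using h1 w l hL
  exact LinearMap.congr_fun h2 r

theorem pairing_mul_eq_zero_right {L : Submodule K (FreeTwo K)} (hr : rightQuot L ≤ L)
    {a : FreeTwo K} (ha : ∀ l ∈ L, pairing a l = 0) (r : FreeTwo K) :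
    ∀ l ∈ L, pairing (a * r) l = 0 := by
  intro l hL
  have hr' : leftQuot (reversed L) ≤ reversed L := by
    have := reversed_mono hr
    rwa [rightQuot_eq, reversed_reversed] at this
  have := pairing_mul_eq_zero_left (a := reversal a) hr' (fun l hl => by
    rw [pairing_reversal]; exact ha _ (mem_reversed.1 hl)) (reversal r) (reversal l)
    (by rwa [mem_reversed, reversal_reversal])
  rwa [← reversal_mul, pairing_reversal, reversal_reversal] at this

/-- The ideal of the elements orthogonal to a space closed under quotients by letters. -/
noncomputable def orthogonalIdeal (L : Submodule K (FreeTwo K)) (hl : leftQuot L ≤ L)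
    (hr : rightQuot L ≤ L) : AlgIdeal K (augIdeal K) where
  carrier := {a | ∀ l ∈ L, pairing (a : FreeTwo K) l = 0}
  add_mem' := fun {a b} ha hb l hL => by
    rw [NonUnitalSubalgebra.coe_add, map_add, LinearMap.add_apply, ha l hL, hb l hL, add_zero]
  zero_mem' := fun l _ => by simp
  smul_mem' := fun c a ha l hL => by
    rw [NonUnitalSubalgebra.coe_smul, map_smul, LinearMap.smul_apply, ha l hL, smul_zero]
  mul_mem_left' := fun r _ ha l hL => pairing_mul_eq_zero_left hl ha r l hL
  mul_mem_right' := fun r _ ha l hL => pairing_mul_eq_zero_right hr ha r l hL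

variable {L : Submodule K (FreeTwo K)} {hl : leftQuot L ≤ L} {hr : rightQuot L ≤ L}

theorem proj_orthogonalIdeal_eq_zero {a : augIdeal K} :
    (orthogonalIdeal L hl hr).proj a = 0 ↔ ∀ l ∈ L, pairing (a : FreeTwo K) l = 0 :=
  Submodule.Quotient.mk_eq_zero _

end Ideal

/-! ### Grading, generators and dimensions of the quotient -/

section Grading

variable {K : Type*} [Field K] (E : AlgIdeal K (augIdeal K))

/-- The homogeneous component of degree `n` as a map of `augIdeal K` into itself. -/
noncomputable def augComponent (K : Type*) [Field K] (n : ℕ) : augIdeal K →ₗ[K] augIdeal K where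
  toFun a := ⟨component n a, component_mem_augIdeal a.2 n⟩
  map_add' a b := Subtype.ext (by simp)
  map_smul' c a := Subtype.ext (by simp)

variable {E}

theorem proj_mem_quotientPart {n : ℕ} {a : augIdeal K} (ha : (a : FreeTwo K) ∈ homogeneousPart K n) :
    E.proj a ∈ quotientPart E n :=
  Submodule.mem_map_of_mem (f := E.proj) (p := (homogeneousPart K n).comap
    (augIdeal K).toSubmodule.subtype) ha

theorem exists_of_mem_quotientPart {n : ℕ} {x : E.Quotient} (hx : x ∈ quotientPart E n) :
    ∃ a : augIdeal K, (a : FreeTwo K) ∈ homogeneousPart K n ∧ E.proj a = x := by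
  obtain ⟨a, ha, rfl⟩ := Submodule.mem_map.1 hx
  exact ⟨a, ha, rfl⟩

theorem quotientPart_mul {m n : ℕ} {a b : E.Quotient} (ha : a ∈ quotientPart E m)
    (hb : b ∈ quotientPart E n) : a * b ∈ quotientPart E (m + n) := by
  obtain ⟨a, ha', rfl⟩ := exists_of_mem_quotientPart ha
  obtain ⟨b, hb', rfl⟩ := exists_of_mem_quotientPart hb
  rw [← AlgIdeal.proj_mul]
  refine proj_mem_quotientPart ?_
  rw [← homogeneousPart_mul]
  exact Submodule.mul_mem_mul ha' hb'

/-- An ideal stable under taking components lets the component maps descend to the quotient, where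
they separate the parts. -/
theorem isInternal_quotientPart
    (hE : ∀ n, ∀ a : augIdeal K, E.proj a = 0 → E.proj (augComponent K n a) = 0) :
    DirectSum.IsInternal (quotientPart E) := by
  have hker : ∀ n, LinearMap.ker E.proj ≤ LinearMap.ker (E.proj ∘ₗ augComponent K n) :=
    fun n a ha => hE n a ha
  have hlift : ∀ n, ∃ π : E.Quotient →ₗ[K] E.Quotient,
      ∀ a, π (E.proj a) = E.proj (augComponent K n a) := fun n =>
    ⟨E.toSubmodule.liftQ (E.proj ∘ₗ augComponent K n) (by
      have h := hker n
      rwa [show LinearMap.ker E.proj = E.toSubmodule from Submodule.ker_mkQ _] at h),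
      fun a => Submodule.liftQ_apply _ _ a⟩
  choose π hπ using hlift
  have hπ' : ∀ m n, ∀ x ∈ quotientPart E m, π n x = if m = n then x else 0 := by
    intro m n x hx
    obtain ⟨a, ha, rfl⟩ := exists_of_mem_quotientPart hx
    rw [hπ]
    have : augComponent K n a = if m = n then a else 0 := Subtype.ext (by
      change component n (a : FreeTwo K) = _
      rw [component_of_mem ha]; split_ifs <;> rfl)
    rw [this]; split_ifs <;> simp
  rw [DirectSum.isInternal_submodule_iff_iSupIndep_and_iSup_eq_top]
  constructor
  · intro n
    rw [Submodule.disjoint_def]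
    intro x hx hx'
    have h1 : ⨆ m, ⨆ (_ : m ≠ n), quotientPart E m ≤ LinearMap.ker (π n) :=
      iSup_le fun m => iSup_le fun hm => fun y hy => by
        rw [LinearMap.mem_ker, hπ' m n y hy, if_neg hm]
    have h2 := hπ' n n x hx
    rw [if_pos rfl, LinearMap.mem_ker.1 (h1 hx')] at h2
    exact h2.symm
  · rw [eq_top_iff]
    intro x _
    obtain ⟨a, rfl⟩ := E.proj_surjective x
    obtain ⟨d, hd⟩ := exists_sum_component (a : FreeTwo K)
    have h1 : ∑ i ∈ Finset.range (d + 1), augComponent K i a = a := Subtype.ext (by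
      have : ((∑ i ∈ Finset.range (d + 1), augComponent K i a : augIdeal K) : FreeTwo K) =
          ∑ i ∈ Finset.range (d + 1), component i (a : FreeTwo K) :=
        map_sum (augIdeal K).toSubmodule.subtype _ _
      rw [this, hd d le_rfl])
    rw [← h1, map_sum]
    refine Submodule.sum_mem _ fun i _ => ?_
    exact (le_iSup (quotientPart E) i) (proj_mem_quotientPart (component_mem i (a : FreeTwo K)))

theorem adjoin_proj_augVar :
    NonUnitalAlgebra.adjoin K {E.proj (augVar K 0), E.proj (augVar K 1)} = ⊤ := by
  rw [eq_top_iff]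
  intro x _
  obtain ⟨a, rfl⟩ := E.proj_surjective x
  set S := NonUnitalAlgebra.adjoin K {E.proj (augVar K 0), E.proj (augVar K 1)}
  have hS : ∀ i, E.proj (augVar K i) ∈ S := fun i =>
    NonUnitalAlgebra.subset_adjoin K (by fin_cases i <;> simp)
  have hword : ∀ w : List (Fin 2), w ≠ [] → ∃ b : augIdeal K, (b : FreeTwo K) = monomialOf K w ∧
      E.proj b ∈ S := by
    intro w
    induction w with
    | nil => simp
    | cons i w ih =>
      intro _
      rcases eq_or_ne w [] with rfl | hw
      · exact ⟨augVar K i, by simp [augVar], hS i⟩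
      · obtain ⟨b, hb, hbS⟩ := ih hw
        refine ⟨augVar K i * b, ?_, ?_⟩
        · rw [monomialOf_cons, ← hb]; rfl
        · rw [AlgIdeal.proj_mul]; exact mul_mem (hS i) hbS
  -- Removing the constant term allows linear induction over all words, the empty one included.
  have hmem : ∀ a : FreeTwo K, ∃ b : augIdeal K, (b : FreeTwo K) = a - component 0 a ∧
      E.proj b ∈ S := by
    intro a
    have : a ∈ Submodule.span K (Set.range (monomialOf K)) := by rw [span_monomial]; trivial
    induction this using Submodule.span_induction with
    | mem a h =>
      obtain ⟨w, rfl⟩ := h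
      rcases eq_or_ne w [] with rfl | hw
      · exact ⟨0, by simp [component_one], by rw [map_zero]; exact zero_mem _⟩
      · obtain ⟨b, hb, hbS⟩ := hword w hw
        refine ⟨b, ?_, hbS⟩
        rw [component_monomialOf, if_neg (by simpa using hw), sub_zero, hb]
    | zero => exact ⟨0, by simp, by rw [map_zero]; exact zero_mem _⟩
    | add x y _ _ hx hy =>
      obtain ⟨b, hb, hbS⟩ := hx
      obtain ⟨c, hc, hcS⟩ := hy
      refine ⟨b + c, ?_, by rw [map_add]; exact add_mem hbS hcS⟩
      rw [NonUnitalSubalgebra.coe_add, hb, hc, map_add]; abel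
    | smul r x _ hx =>
      obtain ⟨b, hb, hbS⟩ := hx
      refine ⟨r • b, ?_, by rw [map_smul]; exact SMulMemClass.smul_mem r hbS⟩
      rw [NonUnitalSubalgebra.coe_smul, hb, map_smul, smul_sub]
  obtain ⟨b, hb, hbS⟩ := hmem a
  rw [component_zero_eq_zero a.2, sub_zero] at hb
  rwa [← Subtype.ext hb]

theorem powSucc_proj (a : augIdeal K) (n : ℕ) :
    powSucc (E.proj a) n = E.proj (powSucc a n) := by
  induction n with
  | zero => rfl
  | succ n ih => rw [powSucc, ih, powSucc, AlgIdeal.proj_mul]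

theorem coe_powSucc (a : augIdeal K) (n : ℕ) :
    ((powSucc a n : augIdeal K) : FreeTwo K) = (a : FreeTwo K) ^ (n + 1) := by
  induction n with
  | zero => simp [powSucc]
  | succ n ih => rw [powSucc, NonUnitalSubalgebra.coe_mul, ih, pow_succ _ (n + 1)]

theorem spannedBy_range_of_ker_le {D M ι : Type*} [AddCommGroup D] [Module K D]
    [Module.Finite K D] [AddCommGroup M] [Module K M] [Fintype ι] (f : D →ₗ[K] M)
    (T : D →ₗ[K] (ι → K)) (hker : ∀ x, T x = 0 → f x = 0) :
    SpannedBy (LinearMap.range f) (Fintype.card ι) := by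
  have h1 := LinearMap.finrank_range_add_finrank_ker T
  have h2 := LinearMap.finrank_range_add_finrank_ker f
  have h3 : finrank K (LinearMap.ker T) ≤ finrank K (LinearMap.ker f) :=
    Submodule.finrank_mono fun x hx => hker x hx
  have h4 : finrank K (LinearMap.range T) ≤ Fintype.card ι :=
    (Submodule.finrank_le _).trans (by simp)
  exact SpannedBy.of_finrank (by omega)

/-- A polynomial of degree `n` killed by the at most `d` functionals coming from `B` is zero in the
quotient, so the rank is at most `d`. -/
theorem spannedBy_quotientPart {L B : Submodule K (FreeTwo K)} {hl : leftQuot L ≤ L}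
    {hr : rightQuot L ≤ L} {n d : ℕ} (hB : SpannedBy B d)
    (h : ∀ l ∈ L, component n l ∈ B) :
    SpannedBy (quotientPart (orthogonalIdeal L hl hr) n) d := by
  obtain ⟨S, hS, hBS⟩ := hB
  let f : homogeneousPart K n →ₗ[K] (orthogonalIdeal L hl hr).Quotient :=
    (orthogonalIdeal L hl hr).proj ∘ₗ
      -- Nonzero constants are not in `augIdeal K`; the value `0` in degree `0` matches the
      -- vanishing of that part.
      { toFun := fun a => if hn : n = 0 then 0 else ⟨a, mem_augIdeal_of_mem hn a.2⟩
        map_add' := fun a b => by split_ifs <;> simp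
        map_smul' := fun c a => by split_ifs <;> simp }
  have hf := spannedBy_range_of_ker_le (ι := S) f (LinearMap.pi fun s =>
    pairing.flip (s : FreeTwo K) ∘ₗ (homogeneousPart K n).subtype) ?_
  · refine hf.mono ?_ (by simpa using hS)
    intro x hx
    obtain ⟨a, ha, rfl⟩ := exists_of_mem_quotientPart hx
    rcases eq_or_ne n 0 with rfl | hn
    · have : a = 0 := Subtype.ext (by
        rw [← component_self ha, component_zero_eq_zero a.2]; rfl)
      rw [this, map_zero]
      exact zero_mem _
    · refine ⟨⟨a, ha⟩, ?_⟩
      simp only [f, LinearMap.comp_apply, LinearMap.coe_mk, AddHom.coe_mk, dif_neg hn]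
  · intro a ha
    refine proj_orthogonalIdeal_eq_zero.2 fun l hL => ?_
    simp only [LinearMap.coe_mk, AddHom.coe_mk]
    split_ifs with hn
    · simp
    · have h1 : Submodule.span K (S : Set (FreeTwo K)) ≤
          LinearMap.ker (pairing (a : FreeTwo K)) := by
        rw [Submodule.span_le]
        intro s hs
        exact congrFun ha ⟨s, hs⟩
      have h2 : pairing (a : FreeTwo K) (component n l) = 0 := h1 (hBS (h l hL))
      rwa [← pairing_component, component_self a.2] at h2

end Grading

/-! ### Growth and Gelfand–Kirillov dimension -/

section Growth

variable {K : Type*} [Field K] {E : AlgIdeal K (augIdeal K)}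

/-- The image of the polynomials of degree at most `t`. -/
noncomputable def quotientPartsUpTo (E : AlgIdeal K (augIdeal K)) (t : ℕ) :
    Submodule K E.Quotient :=
  (Finset.range (t + 1)).sup (quotientPart E)

theorem quotientPart_le_quotientPartsUpTo {i t : ℕ} (h : i ≤ t) :
    quotientPart E i ≤ quotientPartsUpTo E t :=
  Finset.le_sup (f := quotientPart E) (Finset.mem_range.2 (by omega))

theorem quotientPartsUpTo_mono {s t : ℕ} (h : s ≤ t) :
    quotientPartsUpTo E s ≤ quotientPartsUpTo E t :=
  Finset.sup_mono (Finset.range_mono (by omega))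

theorem exists_mem_quotientPartsUpTo (x : E.Quotient) : ∃ t, x ∈ quotientPartsUpTo E t := by
  obtain ⟨a, rfl⟩ := E.proj_surjective x
  obtain ⟨d, hd⟩ := exists_sum_component (a : FreeTwo K)
  have h1 : ∑ i ∈ Finset.range (d + 1), augComponent K i a = a := Subtype.ext (by
    have : ((∑ i ∈ Finset.range (d + 1), augComponent K i a : augIdeal K) : FreeTwo K) =
        ∑ i ∈ Finset.range (d + 1), component i (a : FreeTwo K) :=
      map_sum (augIdeal K).toSubmodule.subtype _ _
    rw [this, hd d le_rfl])
  refine ⟨d, ?_⟩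
  rw [← h1, map_sum]
  refine Submodule.sum_mem _ fun i hi => ?_
  exact quotientPart_le_quotientPartsUpTo (by simpa [Nat.lt_succ_iff] using hi)
    (proj_mem_quotientPart (component_mem i (a : FreeTwo K)))

theorem exists_le_quotientPartsUpTo (V : Submodule K E.Quotient) [Module.Finite K V] :
    ∃ t, V ≤ quotientPartsUpTo E t := by
  classical
  obtain ⟨S, hS⟩ := (Module.Finite.iff_fg.1 ‹Module.Finite K V› : V.FG)
  suffices h : ∃ t, ∀ s ∈ S, s ∈ quotientPartsUpTo E t by
    obtain ⟨t, ht⟩ := h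
    exact ⟨t, by rw [← hS, Submodule.span_le]; exact ht⟩
  clear hS
  induction S using Finset.induction_on with
  | empty => exact ⟨0, by simp⟩
  | insert a S _ ih =>
    obtain ⟨t, ht⟩ := ih
    obtain ⟨s, hs⟩ := exists_mem_quotientPartsUpTo a
    refine ⟨max s t, fun x hx => ?_⟩
    rcases Finset.mem_insert.1 hx with rfl | hx
    · exact quotientPartsUpTo_mono (le_max_left _ _) hs
    · exact quotientPartsUpTo_mono (le_max_right _ _) (ht x hx)

theorem map₂_quotientPartsUpTo_le (s t : ℕ) :
    Submodule.map₂ (LinearMap.mul K E.Quotient) (quotientPartsUpTo E s) (quotientPartsUpTo E t) ≤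
      quotientPartsUpTo E (s + t) := by
  refine Submodule.map₂_le.2 fun x hx y hy => ?_
  have h1 : ∀ i ≤ s, ∀ a ∈ quotientPart E i, quotientPartsUpTo E t ≤
      (quotientPartsUpTo E (s + t)).comap (LinearMap.mulLeft K a) := fun i hi a ha =>
    Finset.sup_le fun j hj b hb => by
      rw [Finset.mem_range] at hj
      exact quotientPart_le_quotientPartsUpTo (by omega) (quotientPart_mul ha hb)
  have h2 : quotientPartsUpTo E s ≤
      (quotientPartsUpTo E (s + t)).comap (LinearMap.mulRight K y) :=
    Finset.sup_le fun i hi a ha => by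
      rw [Finset.mem_range] at hi
      exact h1 i (by omega) a ha hy
  exact h2 hx

theorem subspacePowSucc_le_quotientPartsUpTo {V : Submodule K E.Quotient} {t : ℕ}
    (hV : V ≤ quotientPartsUpTo E t) (i : ℕ) :
    subspacePowSucc V i ≤ quotientPartsUpTo E (t * (i + 1)) := by
  induction i with
  | zero => simpa [subspacePowSucc] using hV
  | succ i ih =>
    rw [subspacePowSucc, show t * (i + 1 + 1) = t * (i + 1) + t by ring]
    exact (Submodule.map₂_le_map₂ ih hV).trans (map₂_quotientPartsUpTo_le _ _)

theorem growth_le {V : Submodule K E.Quotient} {t D n : ℕ} (hV : V ≤ quotientPartsUpTo E t)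
    (hD : ∀ j ≤ t * n, SpannedBy (quotientPart E j) D) : growth V n ≤ (t * n + 1) * D := by
  have h1 : SpannedBy (quotientPartsUpTo E (t * n)) ((t * n + 1) * D) := by
    have := SpannedBy.finsetSup (Finset.range (t * n + 1)) (quotientPart E) (d := D)
      fun j hj => hD j (by rw [Finset.mem_range] at hj; omega)
    rwa [Finset.card_range] at this
  refine (h1.mono (iSup_le fun i => ?_) le_rfl).finrank_le
  exact (subspacePowSucc_le_quotientPartsUpTo hV i).trans
    (quotientPartsUpTo_mono (Nat.mul_le_mul_left _ i.2))

theorem growth_le_rpow {V : Submodule K E.Quotient} {t : ℕ} (hV : V ≤ quotientPartsUpTo E t)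
    {C s : ℝ} (hC : 1 ≤ C) (hs : 0 ≤ s) {d : ℕ → ℕ} (hd : ∀ n, SpannedBy (quotientPart E n) (d n))
    (hdC : ∀ n : ℕ, (d n : ℝ) ≤ C * ((n : ℝ) + 1) ^ s) {n : ℕ} (hn : 1 ≤ n) :
    (growth V n : ℝ) ≤ C * ((t : ℝ) + 1) ^ (s + 1) * (n : ℝ) ^ (s + 1) := by
  have hD : ∀ j ≤ t * n, SpannedBy (quotientPart E j) ⌊C * ((t * n : ℕ) + 1 : ℝ) ^ s⌋₊ :=
    fun j hj => (hd j).mono le_rfl (Nat.le_floor ((hdC j).trans (by gcongr)))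
  have h1 := growth_le hV hD
  have hn' : (1 : ℝ) ≤ n := by exact_mod_cast hn
  have h2 : (t : ℝ) * n + 1 ≤ (t + 1) * n := by nlinarith
  calc (growth V n : ℝ) ≤ ((t * n + 1) * ⌊C * ((t * n : ℕ) + 1 : ℝ) ^ s⌋₊ : ℕ) := by
        exact_mod_cast h1
    _ ≤ ((t : ℝ) * n + 1) * (C * ((t : ℝ) * n + 1) ^ s) := by
        push_cast
        gcongr
        refine (Nat.floor_le (by positivity)).trans le_rfl
    _ = C * ((t : ℝ) * n + 1) ^ (s + 1) := by
        rw [Real.rpow_add_one (by positivity)]; ring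
    _ ≤ C * ((t + 1) * n) ^ (s + 1) := by gcongr
    _ = _ := by rw [Real.mul_rpow (by positivity) (by positivity)]; ring

theorem limsup_log_div_log_le {u : ℕ → ℕ} {C s : ℝ} (hC : 1 ≤ C) (hs : 0 ≤ s)
    (h : ∀ n : ℕ, 1 ≤ n → (u n : ℝ) ≤ C * (n : ℝ) ^ s) :
    Filter.limsup (fun n : ℕ => ((Real.log (u n) / Real.log n : ℝ) : EReal)) Filter.atTop ≤
      (s : EReal) := by
  have h1 : Filter.Tendsto (fun n : ℕ => ((Real.log C / Real.log n + s : ℝ) : EReal))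
      Filter.atTop (nhds (s : EReal)) := by
    refine (continuous_coe_real_ereal.tendsto s).comp ?_
    have := ((Real.tendsto_log_atTop.comp tendsto_natCast_atTop_atTop).const_div_atTop
      (Real.log C)).add_const s
    simpa using this
  rw [← h1.limsup_eq]
  refine Filter.limsup_le_limsup ?_
  filter_upwards [Filter.eventually_ge_atTop 2] with n hn
  rw [EReal.coe_le_coe_iff]
  have hn' : (1 : ℝ) < n := by exact_mod_cast hn
  have hlog : 0 < Real.log n := Real.log_pos hn'
  rw [div_add' _ _ _ hlog.ne', div_le_div_iff_of_pos_right hlog]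
  have hlogC : 0 ≤ Real.log C := Real.log_nonneg hC
  rcases Nat.eq_zero_or_pos (u n) with h0 | h0
  · rw [h0, Nat.cast_zero, Real.log_zero]; positivity
  · have h2 := Real.log_le_log (by exact_mod_cast h0) (h n (by omega))
    rwa [Real.log_mul (by positivity) (by positivity), Real.log_rpow (by positivity)] at h2

/-- If `V` lives in degrees at most `t`, then `V + ⋯ + V ^ n` lives in degrees at most `t * n`.
Summing parts of order `j ^ (2 + ε)` gives `n ^ (3 + ε)`, and constants vanish in the upper limit.
-/
theorem GKdim_le_three {d : ℕ → ℕ} (hd : ∀ n, SpannedBy (quotientPart E n) (d n))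
    (h : ∀ ε : ℝ, 0 < ε → ∃ C : ℝ, ∀ n : ℕ, (d n : ℝ) ≤ C * ((n : ℝ) + 1) ^ (2 + ε)) :
    GKdim K E.Quotient ≤ 3 := by
  refine iSup_le fun V => ?_
  obtain ⟨V, hV⟩ := V
  obtain ⟨t, ht⟩ := exists_le_quotientPartsUpTo V
  rw [← EReal.le_of_forall_lt_iff_le]
  intro z hz
  have hz' : (3 : ℝ) < z := EReal.coe_lt_coe_iff.1 hz
  obtain ⟨C, hC⟩ := h (z - 3) (by linarith)
  have hC' : ∀ n : ℕ, (d n : ℝ) ≤ max C 1 * ((n : ℝ) + 1) ^ (z - 1) := fun n => by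
    have := hC n
    rw [show 2 + (z - 3) = z - 1 by ring] at this
    refine this.trans ?_
    gcongr
    exact le_max_left _ _
  refine limsup_log_div_log_le (C := max C 1 * ((t : ℝ) + 1) ^ z) ?_ (by linarith) fun n hn => ?_
  · exact one_le_mul_of_one_le_of_one_le (le_max_right _ _)
      (Real.one_le_rpow (by linarith [Nat.cast_nonneg (α := ℝ) t]) (by linarith))
  · have := growth_le_rpow ht (le_max_right C 1) (by linarith) hd hC' hn
    rwa [sub_add_cancel] at this

end Growth

/-! ### Towers and the algebra attached to a tower -/

section Towers

/-- A sequence of pairs of homogeneous polynomials, each pair obtained from the preceding one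
by a substitution. -/
structure Tower (K : Type*) [Field K] where
  /-- the degrees of the polynomials -/
  n : ℕ → ℕ
  /-- half the degree of the substituted polynomials -/
  γ : ℕ → ℕ
  /-- the exponents of the leading factor -/
  e : ℕ → ℕ
  /-- the polynomials -/
  g : ℕ → Fin 2 → FreeTwo K
  /-- the polynomials in which the generators are substituted -/
  ψ : ℕ → Fin 2 → FreeTwo K
  n_zero : n 0 = 1
  n_succ : ∀ k, n (k + 1) = (e k + 2 * γ k) * n k
  n_lt : ∀ k, n k < n (k + 1)
  g_mem : ∀ k i, g k i ∈ homogeneousPart K (n k)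
  g_li : ∀ k, LinearIndependent K (g k)
  ψ_mem : ∀ k i, ψ k i ∈ homogeneousPart K (2 * γ k)
  g_succ : ∀ k i, g (k + 1) i = g k 0 ^ e k * substitute (g k) (ψ k i)

namespace Tower

variable {K : Type*} [Field K] (τ : Tower K)

theorem n_strictMono : StrictMono τ.n := strictMono_nat_of_lt_succ τ.n_lt

theorem n_pos (k : ℕ) : 0 < τ.n k :=
  lt_of_lt_of_le (by rw [τ.n_zero]; exact one_pos) (τ.n_strictMono.monotone (Nat.zero_le k))

/-- The span of the `k`-th pair. -/
noncomputable def space (k : ℕ) : Submodule K (FreeTwo K) := Submodule.span K (Set.range (τ.g k))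

/-- The span of the first polynomial of the `k`-th pair. -/
noncomputable def line (k : ℕ) : Submodule K (FreeTwo K) := Submodule.span K {τ.g k 0}

/-- The span of the `k`-th pair of substituted polynomials. -/
noncomputable def pattern (k : ℕ) : Submodule K (FreeTwo K) := Submodule.span K (Set.range (τ.ψ k))

theorem g_mem_space (k : ℕ) (i : Fin 2) : τ.g k i ∈ τ.space k := Submodule.subset_span ⟨i, rfl⟩

theorem line_le (k : ℕ) : τ.line k ≤ τ.space k := by
  rw [line, Submodule.span_singleton_le_iff_mem]; exact τ.g_mem_space k 0

theorem space_le (k : ℕ) : τ.space k ≤ homogeneousPart K (τ.n k) := by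
  rw [space, Submodule.span_le]; rintro _ ⟨i, rfl⟩; exact τ.g_mem k i

theorem pattern_le (k : ℕ) : τ.pattern k ≤ homogeneousPart K (2 * τ.γ k) := by
  rw [pattern, Submodule.span_le]; rintro _ ⟨i, rfl⟩; exact τ.ψ_mem k i

theorem spannedBy_line (k : ℕ) : SpannedBy (τ.line k) 1 := ⟨{τ.g k 0}, by simp, by simp [line]⟩

theorem _root_.spannedBy_span_range {K M : Type*} [Field K] [AddCommGroup M] [Module K M]
    (v : Fin 2 → M) : SpannedBy (Submodule.span K (Set.range v)) 2 := by
  classical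
  exact ⟨Finset.univ.image v, Finset.card_image_le.trans (by simp), by simp⟩

theorem space_succ_le (k : ℕ) : τ.space (k + 1) ≤
    τ.line k ^ τ.e k * (τ.pattern k).map (substitute (τ.g k)).toLinearMap := by
  rw [space, Submodule.span_le]
  rintro _ ⟨i, rfl⟩
  rw [τ.g_succ]
  exact Submodule.mul_mem_mul (Submodule.pow_mem_pow _ (Submodule.mem_span_singleton_self _) _)
    (Submodule.mem_map_of_mem (Submodule.subset_span ⟨i, rfl⟩))

theorem map_pattern_le (k : ℕ) : (τ.pattern k).map (substitute (τ.g k)).toLinearMap ≤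
    τ.space k ^ (2 * τ.γ k) := map_substitute_le (τ.g_mem_space k) (τ.pattern_le k)

/-- Later stages consist of products of whole blocks of stage `k`, aligned at multiples of `n k`. -/
theorem space_le_pow (k j : ℕ) : ∃ t, t * τ.n k = τ.n (k + j) ∧ τ.space (k + j) ≤ τ.space k ^ t := by
  induction j with
  | zero => exact ⟨1, by simp, by simp⟩
  | succ j ih =>
    obtain ⟨t, ht, h⟩ := ih
    refine ⟨t * (τ.e (k + j) + 2 * τ.γ (k + j)), ?_, ?_⟩
    · rw [← add_assoc, τ.n_succ, ← ht]; ring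
    · rw [← add_assoc, pow_mul]
      refine (τ.space_succ_le (k + j)).trans ?_
      refine le_trans ?_ (pow_le_pow_left' h _)
      rw [pow_add]
      exact mul_le_mul' (pow_le_pow_left' (τ.line_le _) _) (τ.map_pattern_le _)

/-- The space of all factors of the polynomials of the tower. -/
noncomputable def factorSpace : Submodule K (FreeTwo K) :=
  ⨆ k, ⨆ a, ⨆ b, leftQuot^[a] (rightQuot^[b] (τ.space k))

theorem le_factorSpace (k a b : ℕ) :
    leftQuot^[a] (rightQuot^[b] (τ.space k)) ≤ τ.factorSpace :=
  le_iSup_of_le k (le_iSup_of_le a (le_iSup_of_le b le_rfl))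

theorem factorSpace_le {V : Submodule K (FreeTwo K)}
    (h : ∀ k a b, leftQuot^[a] (rightQuot^[b] (τ.space k)) ≤ V) : τ.factorSpace ≤ V :=
  iSup_le fun k => iSup_le fun a => iSup_le fun b => h k a b

theorem leftQuot_factorSpace : leftQuot τ.factorSpace ≤ τ.factorSpace :=
  leftQuot_le fun i l hl => by
    have : τ.factorSpace ≤ τ.factorSpace.comap (leftDiv i) := τ.factorSpace_le fun k a b x hx => by
      refine τ.le_factorSpace k (a + 1) b ?_
      rw [Function.iterate_succ_apply']
      exact leftDiv_mem_leftQuot hx i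
    exact this hl

theorem rightQuot_factorSpace : rightQuot τ.factorSpace ≤ τ.factorSpace :=
  iSup_le fun i => Submodule.map_le_iff_le_comap.2 <| τ.factorSpace_le fun k a b x hx => by
    refine τ.le_factorSpace k a (b + 1) ?_
    rw [leftQuot_rightQuot_iterate, Function.iterate_succ_apply', ← leftQuot_rightQuot_iterate]
    exact rightDiv_mem_rightQuot hx i

theorem factor_homogeneous (k a b : ℕ) : a + b ≤ τ.n k ∧
    leftQuot^[a] (rightQuot^[b] (τ.space k)) ≤ homogeneousPart K (τ.n k - a - b) ∨
    leftQuot^[a] (rightQuot^[b] (τ.space k)) = ⊥ := by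
  rcases lt_or_ge (τ.n k) b with hb | hb
  · right
    rw [leftQuot_rightQuot_iterate, rightQuot_iterate_eq_bot (n := τ.n k - a) ?_ (by omega)]
    rcases lt_or_ge (τ.n k) a with ha | ha
    · rw [leftQuot_iterate_eq_bot (τ.space_le k) ha]; exact bot_le
    · exact leftQuot_iterate_homogeneousPart (by
        rw [Nat.sub_add_cancel ha]; exact τ.space_le k)
  · have h1 : rightQuot^[b] (τ.space k) ≤ homogeneousPart K (τ.n k - b) :=
      rightQuot_iterate_homogeneousPart (by rw [Nat.sub_add_cancel hb]; exact τ.space_le k)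
    rcases lt_or_ge (τ.n k - b) a with ha | ha
    · exact Or.inr (leftQuot_iterate_eq_bot h1 ha)
    · refine Or.inl ⟨by omega, leftQuot_iterate_homogeneousPart ?_⟩
      rwa [show τ.n k - a - b + a = τ.n k - b by omega]

theorem component_mem_of_factors {m : ℕ} {V : Submodule K (FreeTwo K)}
    (h : ∀ k a b, a + b + m = τ.n k → leftQuot^[a] (rightQuot^[b] (τ.space k)) ≤ V) :
    ∀ l ∈ τ.factorSpace, component m l ∈ V := by
  have : τ.factorSpace ≤ V.comap (component m) := τ.factorSpace_le fun k a b x hx => by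
    rw [Submodule.mem_comap]
    rcases τ.factor_homogeneous k a b with ⟨hab, h1⟩ | h1
    · rw [component_of_mem (h1 hx)]
      split_ifs with hm
      · exact h k a b (by omega) hx
      · exact zero_mem _
    · rw [h1, Submodule.mem_bot] at hx
      rw [hx, map_zero]; exact zero_mem _
  exact this

theorem component_factorSpace (m : ℕ) : ∀ l ∈ τ.factorSpace, component m l ∈ τ.factorSpace :=
  τ.component_mem_of_factors fun k a b _ => τ.le_factorSpace k a b

/-- The defining ideal of the algebra attached to the tower. -/
noncomputable def ideal : AlgIdeal K (augIdeal K) :=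
  orthogonalIdeal τ.factorSpace τ.leftQuot_factorSpace τ.rightQuot_factorSpace

theorem proj_eq_zero {a : augIdeal K} :
    τ.ideal.proj a = 0 ↔ ∀ l ∈ τ.factorSpace, pairing (a : FreeTwo K) l = 0 :=
  proj_orthogonalIdeal_eq_zero

theorem isInternal : DirectSum.IsInternal (quotientPart τ.ideal) :=
  isInternal_quotientPart fun m a ha => τ.proj_eq_zero.2 fun l hl => by
    change pairing (component m (a : FreeTwo K)) l = 0
    rw [pairing_component]
    exact τ.proj_eq_zero.1 ha _ (τ.component_factorSpace m l hl)

/-- Otherwise every word of length `n k` would be orthogonal to `g k 0`, which would then be zero.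
-/
theorem quotientPart_ne_bot (k : ℕ) : quotientPart τ.ideal (τ.n k) ≠ ⊥ := by
  intro h
  refine (τ.g_li k).ne_zero 0 (eq_zero_of_pairing_of_mem (τ.g_mem k 0) fun u hu => ?_)
  have h1 := monomialOf_mem (K := K) hu
  have h2 := proj_mem_quotientPart (E := τ.ideal)
    (a := ⟨monomialOf K u, mem_augIdeal_of_mem (τ.n_pos k).ne' h1⟩) h1
  rw [h, Submodule.mem_bot] at h2
  exact τ.proj_eq_zero.1 h2 _ (τ.le_factorSpace k 0 0 (τ.g_mem_space k 0))

theorem not_finite : ¬ Module.Finite K τ.ideal.Quotient := by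
  intro hfin
  have h1 := ((DirectSum.isInternal_submodule_iff_iSupIndep_and_iSup_eq_top _).1 τ.isInternal).1
  have h2 := WellFoundedGT.finite_ne_bot_of_iSupIndep h1
  refine Set.infinite_of_injective_forall_mem τ.n_strictMono.injective ?_ h2
  exact fun k => τ.quotientPart_ne_bot k

/-- A polynomial whose powers have, at every position, a segment orthogonal to the substituted
polynomials of some stage is nilpotent modulo the ideal. -/
theorem pairing_pow_eq_zero {f : FreeTwo K} (hf0 : component 0 f = 0) {k w : ℕ}
    (hw : w = 2 * τ.γ k * τ.n k) {F : Submodule K (FreeTwo K)} (hFH : F ≤ homogeneousPart K w)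
    (hF : ∀ N p q, component (p + w + q) (f ^ N) ∈ homogeneousPart K p * F * homogeneousPart K q)
    (horth : Orthogonal F ((τ.pattern k).map (substitute (τ.g k)).toLinearMap)) :
    ∀ l ∈ τ.factorSpace, pairing (f ^ (2 * τ.n (k + 1))) l = 0 := by
  set N := 2 * τ.n (k + 1)
  have key : τ.factorSpace ≤ LinearMap.ker (pairing (f ^ N)) := by
    refine τ.factorSpace_le fun m a b l hl => ?_
    rw [LinearMap.mem_ker]
    rcases τ.factor_homogeneous m a b with ⟨hab, h1⟩ | h1
    swap
    · rw [h1, Submodule.mem_bot] at hl; rw [hl, map_zero]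
    set D := τ.n m - a - b with hD
    rw [← component_self (h1 hl), ← pairing_component]
    -- In degrees below `N` the power `f ^ N` has no component; a factor of degree at least `N` is
    -- as long as two blocks of stage `k + 1`.
    rcases lt_or_ge D N with hDN | hDN
    · rw [component_pow_eq_zero hf0 hDN, map_zero, LinearMap.zero_apply]
    have hkm : k + 1 ≤ m := by
      by_contra hcon
      have := τ.n_strictMono.monotone (show m ≤ k + 1 by omega)
      have := τ.n_pos (k + 1)
      omega
    obtain ⟨j, rfl⟩ := Nat.exists_eq_add_of_le hkm
    obtain ⟨t, ht, hG⟩ := τ.space_le_pow (k + 1) j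
    set N' := τ.n (k + 1) with hN'
    have hN'pos : 0 < N' := τ.n_pos (k + 1)
    have hsplit : N' = τ.e k * τ.n k + w := by rw [hN', τ.n_succ, hw]; ring
    -- Block number `i` starts at most `N'` letters after the start of the factor, so it ends within
    -- the first `2 * N'` letters of the factor.
    obtain ⟨i, hi1, hi2⟩ : ∃ i, a ≤ i * N' ∧ i * N' ≤ a + N' := by
      refine ⟨a / N' + 1, ?_, ?_⟩
      · have := Nat.lt_div_mul_add (a := a) hN'pos
        rw [add_mul, one_mul]; exact this.le
      · rw [add_mul, one_mul]
        exact Nat.add_le_add_right (Nat.div_mul_le_self _ _) _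
    have hit : i < t := by
      by_contra hcon
      have : t * N' ≤ i * N' := Nat.mul_le_mul_right _ (by omega)
      omega
    obtain ⟨s, rfl⟩ : ∃ s, t = i + 1 + s := ⟨t - (i + 1), by omega⟩
    -- The segment of `f ^ N` is placed on the last `w` letters of that block, where the substituted
    -- pattern sits behind the power of the line.
    have hc := hF N (i * N' + τ.e k * τ.n k - a) (D - (i * N' + τ.e k * τ.n k - a) - w)
    rw [show i * N' + τ.e k * τ.n k - a + w + (D - (i * N' + τ.e k * τ.n k - a) - w) = D by
      omega] at hc
    set q := D - (i * N' + τ.e k * τ.n k - a) - w with hq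
    refine orthogonal_leftQuot_iterate (C := Submodule.span K {component D (f ^ N)})
      (V := rightQuot^[b] (τ.space (k + 1 + j))) ?_ _ (Submodule.mem_span_singleton_self _) l hl
    refine orthogonal_rightQuot_iterate ?_
    have hpre : homogeneousPart K (i * N' + τ.e k * τ.n k) =
        homogeneousPart K a * homogeneousPart K (i * N' + τ.e k * τ.n k - a) := by
      rw [homogeneousPart_mul]; congr 1; omega
    refine Orthogonal.mono (C := homogeneousPart K (i * N' + τ.e k * τ.n k) *
        (F * (homogeneousPart K q * homogeneousPart K b)))
      (V := (τ.space (k + 1) ^ i * τ.line k ^ τ.e k) *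
        ((τ.pattern k).map (substitute (τ.g k)).toLinearMap * τ.space (k + 1) ^ s)) ?_ ?_ ?_
    · refine orthogonal_mul_of le_rfl ?_ (Or.inr (orthogonal_mul_of hFH ?_ (Or.inl horth)))
      · exact mul_le_homogeneousPart (pow_le_homogeneousPart (τ.space_le _) i)
          (pow_le_homogeneousPart ((τ.line_le k).trans (τ.space_le k)) _)
      · rw [hw]
        exact (τ.map_pattern_le k).trans (pow_le_homogeneousPart (τ.space_le k) _)
    · rw [hpre, ← mul_assoc, ← mul_assoc]
      refine mul_le_mul' ?_ le_rfl
      rw [mul_assoc, mul_assoc, ← mul_assoc (homogeneousPart K (i * N' + τ.e k * τ.n k - a))]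
      refine mul_le_mul' le_rfl ?_
      rw [Submodule.span_singleton_le_iff_mem]
      exact hc
    · refine hG.trans ?_
      rw [pow_add, pow_succ, mul_assoc, mul_assoc, ← mul_assoc (τ.line k ^ τ.e k)]
      exact mul_le_mul' le_rfl (mul_le_mul' (τ.space_succ_le k) le_rfl)
  exact fun l hl => key hl

/-- The one-sided bounds needed by `factors_step` at stage `k + 1` come from `quotients_step` at
stage `k`; there `e k` does not occur, so they are tiny against `n (k + 1)`. -/
theorem spannedBy_quotientPart_of_le {k m : ℕ} (h1 : τ.n (k + 1) < m) (h2 : m ≤ τ.n (k + 2)) :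
    SpannedBy (quotientPart τ.ideal m)
      (8 * (m + 1) * 2 ^ (2 * τ.γ (k + 1)) * (2 ^ ((2 * τ.γ k + 1) * τ.n k)) ^ 2) := by
  have hquot := quotients_step (N := τ.n k) (e := τ.e k) (β := 2 * τ.γ k)
    ((τ.line_le k).trans (τ.space_le k)) (τ.n_pos k) (τ.spannedBy_line k)
    ((τ.map_pattern_le k).trans (pow_le_homogeneousPart (τ.space_le k) _)) (τ.space_succ_le k)
  rw [τ.n_succ (k + 1)] at h2
  obtain ⟨B, hB, hBle⟩ := factors_step (τ.space_le (k + 1)) (τ.n_pos _) (spannedBy_span_range _)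
    (τ.g_mem_space (k + 1)) (fun r => (hquot r).1) (fun r => (hquot r).2) Nat.one_le_two_pow
    (τ.pattern_le (k + 1)) (spannedBy_span_range _) (τ.line_le _) (τ.spannedBy_line _)
    (τ.space_succ_le (k + 1)) h1 h2
  refine spannedBy_quotientPart hB (τ.component_mem_of_factors fun j a b hab => ?_)
  -- Polynomials of earlier stages have degree below `m`.
  have hj : k + 2 ≤ j := by
    by_contra hcon
    have := τ.n_strictMono.monotone (show j ≤ k + 1 by omega)
    omega
  obtain ⟨i, rfl⟩ := Nat.exists_eq_add_of_le hj
  obtain ⟨t, ht, hG⟩ := τ.space_le_pow (k + 2) i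
  refine (leftQuot_iterate_mono a (rightQuot_iterate_mono b hG)).trans (hBle t a b ?_)
  rw [hab, ← ht, τ.n_succ (k + 1)]

theorem spannedBy_quotientPart_two_pow (m : ℕ) : SpannedBy (quotientPart τ.ideal m) (2 ^ m) :=
  spannedBy_quotientPart (spannedBy_homogeneousPart m) fun l _ => component_mem m l

theorem _root_.le_rpow_div_of_pow_le_pow {x y k l : ℕ} (hk : k ≠ 0) (h : x ^ k ≤ y ^ l) :
    (x : ℝ) ≤ (y : ℝ) ^ ((l : ℝ) / k) := by
  have h1 : ((x : ℝ) ^ k) ≤ (y : ℝ) ^ l := by exact_mod_cast h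
  have h2 := Real.rpow_le_rpow (by positivity) h1 (show (0 : ℝ) ≤ (k : ℝ)⁻¹ by positivity)
  rwa [Real.pow_rpow_inv_natCast (by positivity) hk, ← Real.rpow_natCast, ← Real.rpow_mul
    (by positivity), ← div_eq_mul_inv] at h2

/-- Once `1 / (k + 1) ≤ ε / 3`, the factors `2 ^ (2 * γ (k + 1))` and `M ^ 2` are at most the powers
`1 + ε / 3` and `2 * ε / 3` of `m + 1`. The finitely many lower degrees go into the constant `S`. -/
theorem GKdim_le (h1 : ∀ k, (2 ^ (2 * τ.γ k)) ^ k ≤ τ.n k ^ (k + 1))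
    (h2 : ∀ k, (2 ^ ((2 * τ.γ k + 1) * τ.n k)) ^ (k + 1) ≤ τ.n (k + 1)) :
    GKdim K τ.ideal.Quotient ≤ 3 := by
  have hfin : ∀ m, Module.Finite K (quotientPart τ.ideal m) :=
    fun m => (τ.spannedBy_quotientPart_two_pow m).finite
  refine GKdim_le_three (d := fun m => finrank K (quotientPart τ.ideal m))
    (fun m => SpannedBy.of_finrank le_rfl) fun ε hε => ?_
  obtain ⟨r, hr⟩ := exists_nat_one_div_lt (show 0 < ε / 3 by positivity)
  set S : ℝ := ∑ i ∈ Finset.range (τ.n (r + 1) + 1), (finrank K (quotientPart τ.ideal i) : ℝ)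
  have hS : 0 ≤ S := Finset.sum_nonneg fun i _ => by positivity
  refine ⟨8 + S, fun m => ?_⟩
  have hm1 : (1 : ℝ) ≤ (m : ℝ) + 1 := by linarith [Nat.cast_nonneg (α := ℝ) m]
  have hpow : (1 : ℝ) ≤ ((m : ℝ) + 1) ^ (2 + ε) := Real.one_le_rpow hm1 (by linarith)
  rcases le_or_gt m (τ.n (r + 1)) with hm | hm
  · have h3 : (finrank K (quotientPart τ.ideal m) : ℝ) ≤ S :=
      Finset.single_le_sum (f := fun i => (finrank K (quotientPart τ.ideal i) : ℝ))
        (fun i _ => by positivity) (Finset.mem_range.2 (by omega))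
    calc (finrank K (quotientPart τ.ideal m) : ℝ) ≤ (8 + S) * 1 := by linarith
      _ ≤ _ := by gcongr
  · obtain ⟨k, hrk, hk1, hk2⟩ : ∃ k, r ≤ k ∧ τ.n (k + 1) < m ∧ m ≤ τ.n (k + 2) := by
      have hex : ∃ j, m ≤ τ.n j := ⟨m, τ.n_strictMono.le_apply⟩
      have h3 := Nat.find_spec hex
      have h4 : r + 1 < Nat.find hex := by
        by_contra hcon
        have := τ.n_strictMono.monotone (not_lt.1 hcon)
        omega
      obtain ⟨k, hk⟩ : ∃ k, Nat.find hex = k + 2 := ⟨Nat.find hex - 2, by omega⟩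
      refine ⟨k, by omega, ?_, by rwa [← hk]⟩
      exact not_le.1 (Nat.find_min hex (show k + 1 < Nat.find hex by omega))
    have h3 := (τ.spannedBy_quotientPart_of_le hk1 hk2).finrank_le
    set Q := 2 ^ (2 * τ.γ (k + 1)) with hQ
    set M := 2 ^ ((2 * τ.γ k + 1) * τ.n k) with hM
    have hnm : (τ.n (k + 1) : ℝ) ≤ (m : ℝ) + 1 := by
      have : (τ.n (k + 1) : ℝ) ≤ m := by exact_mod_cast hk1.le
      linarith
    have hkr : 1 / ((k : ℝ) + 1) ≤ ε / 3 := by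
      refine le_trans ?_ hr.le
      have : (r : ℝ) ≤ k := by exact_mod_cast hrk
      exact one_div_le_one_div_of_le (by positivity) (by linarith)
    have hQle : (Q : ℝ) ≤ ((m : ℝ) + 1) ^ (1 + ε / 3) := by
      refine (le_rpow_div_of_pow_le_pow (by omega) (h1 (k + 1))).trans ?_
      refine (Real.rpow_le_rpow (by positivity) hnm (by positivity)).trans ?_
      refine Real.rpow_le_rpow_of_exponent_le hm1 ?_
      have : ((k + 1 + 1 : ℕ) : ℝ) / ((k + 1 : ℕ) : ℝ) = 1 + 1 / ((k : ℝ) + 1) := by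
        push_cast; field_simp
      rw [this]; linarith
    have hMle : (M : ℝ) ≤ ((m : ℝ) + 1) ^ (ε / 3) := by
      have h4 := h2 k
      rw [← pow_one (τ.n (k + 1))] at h4
      refine (le_rpow_div_of_pow_le_pow (by omega) h4).trans ?_
      refine (Real.rpow_le_rpow (by positivity) hnm (by positivity)).trans ?_
      refine Real.rpow_le_rpow_of_exponent_le hm1 ?_
      push_cast
      exact hkr
    have h4 : ((m : ℝ) + 1) * ((m : ℝ) + 1) ^ (1 + ε / 3) * (((m : ℝ) + 1) ^ (ε / 3)) ^ 2 =
        ((m : ℝ) + 1) ^ (2 + ε) := by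
      have hpos : (0 : ℝ) < (m : ℝ) + 1 := by positivity
      conv_lhs => rw [← Real.rpow_natCast, ← Real.rpow_mul hpos.le]
      nth_rewrite 1 [← Real.rpow_one ((m : ℝ) + 1)]
      rw [← Real.rpow_add hpos, ← Real.rpow_add hpos]
      congr 1
      push_cast; ring
    calc (finrank K (quotientPart τ.ideal m) : ℝ)
        ≤ ((8 * (m + 1) * Q * M ^ 2 : ℕ) : ℝ) := by exact_mod_cast h3
      _ = 8 * (((m : ℝ) + 1) * Q * (M : ℝ) ^ 2) := by push_cast; ring
      _ ≤ 8 * (((m : ℝ) + 1) * ((m : ℝ) + 1) ^ (1 + ε / 3) * (((m : ℝ) + 1) ^ (ε / 3)) ^ 2) := by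
        gcongr
      _ = 8 * ((m : ℝ) + 1) ^ (2 + ε) := by rw [h4]
      _ ≤ (8 + S) * ((m : ℝ) + 1) ^ (2 + ε) := by gcongr; linarith

end Tower

end Towers

/-! ### The theorem -/

instance (K : Type*) [Field K] [Countable K] : Countable (FreeTwo K) :=
  (monomialBasis K).repr.toEquiv.injective.countable

theorem mainTheorem1 (K : Type*) [Field K] [Countable K] :
    ∃ E : AlgIdeal K (augIdeal K),
      -- the quotient is graded by the degree
      (DirectSum.IsInternal (quotientPart E) ∧
        ∀ (m n : ℕ) (a b : E.Quotient), a ∈ quotientPart E m → b ∈ quotientPart E n →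
          a * b ∈ quotientPart E (m + n)) ∧
      -- it is generated by the images of `x` and `y`
      NonUnitalAlgebra.adjoin K {E.proj (augVar K 0), E.proj (augVar K 1)} = ⊤ ∧
      IsNilAlgebra E.Quotient ∧
      ¬ Module.Finite K E.Quotient ∧
      GKdim K E.Quotient ≤ 3 := by
  have hc : Countable (augIdeal K) := Subtype.val_injective.countable
  obtain ⟨f, hf⟩ := exists_surjective_nat (augIdeal K)
  have hf0 : ∀ k, component 0 (f k : FreeTwo K) = 0 := fun k => component_zero_eq_zero (f k).2
  choose C hC using fun k => exists_segments (hf0 k)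
  -- The constants `C k` depend on the `f k` alone, so all degrees can be fixed before any pair is
  -- chosen.
  obtain ⟨n, γ, e, hn0, hn⟩ := exists_scales C
  have hnpos : ∀ k, 0 < n k := fun k => by
    have h1 : StrictMono n := strictMono_nat_of_lt_succ fun k => (hn k).2.1
    exact lt_of_lt_of_le (by rw [hn0]; exact one_pos) (h1.monotone (Nat.zero_le k))
  choose F hFH hFd hFseg using fun k => hC k (2 * γ k * n k)
    ((hn k).2.2.1.trans (Nat.le_mul_of_pos_right _ (hnpos k)))
  obtain ⟨g, hg⟩ := exists_generators hn0 (fun k => (hn k).1) hFd (fun k => (hn k).2.2.2.1)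
  choose hgmem hgli ψ hψ hgsucc hψF using hg
  let τ : Tower K := ⟨n, γ, e, g, ψ, hn0, fun k => (hn k).1, fun k => (hn k).2.1, hgmem, hgli,
    hψ, hgsucc⟩
  refine ⟨τ.ideal, ⟨τ.isInternal, fun m n a b => quotientPart_mul⟩, adjoin_proj_augVar, ?_,
    τ.not_finite, τ.GKdim_le (fun k => (hn k).2.2.2.2.1) fun k => (hn k).2.2.2.2.2⟩
  intro x
  obtain ⟨a, rfl⟩ := τ.ideal.proj_surjective x
  obtain ⟨k, rfl⟩ := hf a
  -- `powSucc` shifts exponents by one; the power in question is `2 * n (k + 1)`.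
  refine ⟨2 * n (k + 1) - 1, ?_⟩
  rw [powSucc_proj, τ.proj_eq_zero, coe_powSucc,
    Nat.sub_add_cancel (by have := hnpos (k + 1); omega)]
  refine τ.pairing_pow_eq_zero (hf0 k) rfl (hFH k) (hFseg k) fun c hcF v hv => ?_
  have h1 : τ.pattern k ≤
      LinearMap.ker (pairing.flip c ∘ₗ (substitute (g k)).toLinearMap) := by
    rw [Tower.pattern, Submodule.span_le]
    rintro _ ⟨i, rfl⟩
    exact hψF k i c hcF
  obtain ⟨y, hy, rfl⟩ := Submodule.mem_map.1 hv
  rw [pairing_comm]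
  exact h1 hy
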